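/- **Proposition (Killing tensors in warped products).** All objects are smooth ($C^\infty$); manifolds are finite dimensional and without boundary. On a pseudo-Riemannian manifold $(M,g)$ with contravariant metric $G$, let $S^2(M)$ be the set of symmetric contravariant 2-tensor fields; $K\in S^2(M)$ is a *Killing tensor* if the Schouten bracket $[K,G]$ vanishes, where in local coordinates $$[K,G]=2\,(K^{il}\,\partial_l G^{jk}-G^{il}\,\partial_l K^{jk})\,\partial_i\odot\partial_j\odot\partial_k .$$ A non-degenerate distribution $D\subseteq TM$ is *geodesic* if $(\nabla_XY)^{D^\perp}=0$ for all $X,Y\in\Gamma(D)$. It is *spherical* if there is $N\in\Gamma(D^\perp)$ with $(\nabla_XY)^{D^\perp}=\langle X,Y\rangle N$ and $(\nabla_XN)^{D^\perp}=0$ for all $X,Y\in\Gamma(D)$. It is *Killing* if $D$ is spherical and $D^\perp$ is geodesic. $D$ is *$K$-invariant* if the endomorphism of $TM$ obtained from $K$ by lowering an index maps $D$ into $D$. Let $(M,g)$ be a pseudo-Riemannian manifold, $K\in S^2(M)$, and $D$ a $K$-invariant Killing distribution on $M$. Let $(B,g_B)$ and $(F,g_F)$ be connected pseudo-Riemannian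 manifolds with $\dim F>0$, let $\rho:B\to\mathbb R^+$, and let $B\times_\rho F$ be the warped product, that is, $B\times F$ with the metric $\pi_B^*g_B+\rho^2\pi_F^*g_F$. Suppose it is a local warped product adapted to $(D^\perp,D)$: there is an isometry from $B\times_\rho F$ onto an open set $U\subseteq M$, by which we identify $B\times_\rho F$ with $U$, such that the slices $B\times\{y\}$ and $\{b\}\times F$ are integral manifolds of $D^\perp$ and $D$ respectively. Write $G=G_0+\kappa G_1$ on $U$, where $\kappa=\rho^{-2}$ and $G_0$, $G_1$ are the lifts to $B\times F$ of the contravariant metrics of $B$ and $F$. (The lift of a contravariant tensor field on a factor is its push-forward by the inclusions of the slices.) Then $K$ is a Killing tensor on $U$ if and only if there exist a Killing tensor $K'$ on $(B,g_B)$, a Killing tensor $\tilde K$ on $(F,g_F)$ and a function $t$ on $B$ such that, with tensors on the factors identified with their lifts, $$K=K'+t\,G_1+\tilde K\quad\text{on }U,\qquad dt=K'\,d\kappa ,$$ where in the last equation $K'$ acts on 1-forms on $B$ by means of $g_B$, i.e. $\partial_a t=(g_B)_{ab}K'^{bc}\partial_c\kappa$. Furthermore the lift of every Killing tensor $\tilde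 K$ on $(F,g_F)$ is a Killing tensor on $B\times_\rho F$. -/

import Mathlib

open scoped Manifold ContDiff Topology

noncomputable section

namespace WarpedKilling

/-! ### Tensor fields on a manifold -/

section Tensors

variable {E : Type*} [NormedAddCommGroup E] [NormedSpace ℝ E]
  {H : Type*} [TopologicalSpace H] (I : ModelWithCorners ℝ E H)
  (M : Type*) [TopologicalSpace M] [ChartedSpace H M]

/-- Vector fields on `M` (no regularity imposed). -/
abbrev VField : Type _ := Π x : M, TangentSpace I x

/-- Covariant 2-tensor fields on `M` (no regularity or symmetry imposed). -/
abbrev CovTensor : Type _ := Π x : M, TangentSpace I x →L[ℝ] TangentSpace I x →L[ℝ] ℝ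

/-- Contravariant 2-tensor fields on `M` (no regularity or symmetry imposed), seen as maps
`T*M → TM`. The value of `K` at `x` on two covectors `p`, `q` is `p (K x q)`. -/
abbrev ContraTensor : Type _ := Π x : M, (TangentSpace I x →L[ℝ] ℝ) →L[ℝ] TangentSpace I x

variable {M}

/-- A pseudo-Riemannian metric: a smooth symmetric covariant 2-tensor field which is
non-degenerate at each point. -/
structure IsPseudoRiemannianMetric [IsManifold I ∞ M] (g : CovTensor I M) : Prop where
  symm : ∀ (x : M) (v w : TangentSpace I x), g x v w = g x w v
  nondegenerate : ∀ (x : M) (v : TangentSpace I x), (∀ w, g x v w = 0) → v = 0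
  smooth : ContMDiff I (I.prod 𝓘(ℝ, E →L[ℝ] E →L[ℝ] ℝ)) ∞
    (fun x ↦ Bundle.TotalSpace.mk' (E →L[ℝ] E →L[ℝ] ℝ)
      (E := fun x : M ↦ TangentSpace I x →L[ℝ] TangentSpace I x →L[ℝ] ℝ) x (g x))

/-- The contravariant metric: at each point, the inverse of `v ↦ g(v, ·)`. -/
def cometric (g : CovTensor I M) : ContraTensor I M := fun x ↦ (g x).inverse

/-- `K ∈ S²(M)`: a smooth symmetric contravariant 2-tensor field. Smoothness says that the
function `K(df, dh)` is smooth for all locally defined smooth functions `f` and `h`. -/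
structure IsSymmetricTensorField (K : ContraTensor I M) : Prop where
  symm : ∀ (x : M) (p q : TangentSpace I x →L[ℝ] ℝ), p (K x q) = q (K x p)
  smooth : ∀ (x : M) (f h : M → ℝ), ContMDiffAt I 𝓘(ℝ, ℝ) ∞ f x → ContMDiffAt I 𝓘(ℝ, ℝ) ∞ h x →
    ContMDiffAt I 𝓘(ℝ, ℝ) ∞ (fun y ↦ mvfderiv I f y (K y (mvfderiv I h y))) x

/-- The Schouten bracket `[K, G]` of two symmetric contravariant 2-tensor fields, a symmetric
contravariant 3-tensor field, evaluated at `x` on the differentials of `f₁`, `f₂`, `f₃`.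
When the `fᵢ` are coordinate functions this is the component of
`2 (K dGʲᵏ - G dKʲᵏ) ⊙ ∂ⱼ ⊙ ∂ₖ`, where `⊙` is the symmetrized tensor product; the second
derivatives of the `fᵢ` cancel in the cyclic sum, so the value depends only on `dfᵢ(x)`. -/
def schouten (K G : ContraTensor I M) (f₁ f₂ f₃ : M → ℝ) (x : M) : ℝ :=
  let b (f h : M → ℝ) (T : ContraTensor I M) : M → ℝ :=
    fun y ↦ mvfderiv I f y (T y (mvfderiv I h y))
  let c (u f h : M → ℝ) : ℝ :=
    mvfderiv I (b f h G) x (K x (mvfderiv I u x)) - mvfderiv I (b f h K) x (G x (mvfderiv I u x))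
  (2 / 3 : ℝ) * (c f₁ f₂ f₃ + c f₂ f₃ f₁ + c f₃ f₁ f₂)

/-- The Killing equation `[K, G] = 0` holds at all points of the set `s`, where `G` is the
contravariant metric of `g`. -/
def KillingEquationOn (g : CovTensor I M) (K : ContraTensor I M) (s : Set M) : Prop :=
  ∀ x ∈ s, ∀ f₁ f₂ f₃ : M → ℝ, ContMDiffAt I 𝓘(ℝ, ℝ) ∞ f₁ x → ContMDiffAt I 𝓘(ℝ, ℝ) ∞ f₂ x →
    ContMDiffAt I 𝓘(ℝ, ℝ) ∞ f₃ x → schouten I K (cometric I g) f₁ f₂ f₃ x = 0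

/-- `K` is a Killing tensor of valence 2 on `(M, g)`. -/
structure IsKillingTensor (g : CovTensor I M) (K : ContraTensor I M) : Prop where
  isSymmetricTensorField : IsSymmetricTensorField I K
  killing : KillingEquationOn I g K Set.univ

end Tensors

/-! ### Distributions on a pseudo-Riemannian manifold -/

section Distributions

variable {E : Type*} [NormedAddCommGroup E] [NormedSpace ℝ E]
  {H : Type*} [TopologicalSpace H] (I : ModelWithCorners ℝ E H)
  (M : Type*) [TopologicalSpace M] [ChartedSpace H M]

/-- Families of subspaces of the tangent spaces. -/
abbrev Distribution : Type _ := Π x : M, Submodule ℝ (TangentSpace I x)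

variable {M}

/-- Pointwise orthogonal complement with respect to `g`. -/
def orthogonal (g : CovTensor I M) (D : Distribution I M) : Distribution I M := fun x ↦
  { carrier := {v | ∀ w ∈ D x, g x v w = 0}
    add_mem' := by
      intro a b ha hb w hw
      simp [ha w hw, hb w hw]
    zero_mem' := by
      intro w _
      simp
    smul_mem' := by
      intro c a ha w hw
      simp [ha w hw] }

/-- `D` is `K`-invariant: the endomorphism `v ↦ K(g(v, ·))` of `TM` maps `D` into itself. -/
def IsInvariant (g : CovTensor I M) (K : ContraTensor I M) (D : Distribution I M) : Prop :=
  ∀ (x : M), ∀ v ∈ D x, K x (g x v) ∈ D x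

variable [IsManifold I ∞ M]

/-- The vector field `X` is smooth at `x`. -/
def SmoothVFieldAt (X : VField I M) (x : M) : Prop :=
  ContMDiffAt I (I.prod 𝓘(ℝ, E)) ∞
    (fun y ↦ (Bundle.TotalSpace.mk' E y (X y) : TangentBundle I M)) x

/-- `X` is a smooth section of `D` near `x`. -/
def IsSectionAt (D : Distribution I M) (X : VField I M) (x : M) : Prop :=
  SmoothVFieldAt I X x ∧ ∀ᶠ y in 𝓝 x, X y ∈ D y

/-- `D` is a smooth subbundle of `TM`: near each point it has a smooth frame. -/
def IsSmoothDistribution (D : Distribution I M) : Prop :=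
  ∀ x : M, ∃ (m : ℕ) (X : Fin m → VField I M), (∀ i, SmoothVFieldAt I (X i) x) ∧
    ∀ᶠ y in 𝓝 x, LinearIndependent ℝ (fun i ↦ X i y) ∧
      Submodule.span ℝ (Set.range fun i ↦ X i y) = D y

/-- The metric induced on `D` is non-degenerate. -/
def IsNondegenerate (g : CovTensor I M) (D : Distribution I M) : Prop :=
  ∀ (x : M), ∀ v ∈ D x, (∀ w ∈ D x, g x v w = 0) → v = 0

/-- The function `⟨X, Y⟩`. -/
def pairing (g : CovTensor I M) (X Y : VField I M) : M → ℝ := fun x ↦ g x (X x) (Y x)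

/-- `⟨∇_X Y, Z⟩` at `x` for the Levi-Civita connection `∇` of `g`, by the Koszul formula. -/
def leviCivita (g : CovTensor I M) (X Y Z : VField I M) (x : M) : ℝ :=
  (1 / 2 : ℝ) *
    (mvfderiv I (pairing I g Y Z) x (X x) + mvfderiv I (pairing I g X Z) x (Y x)
      - mvfderiv I (pairing I g X Y) x (Z x)
      + pairing I g (VectorField.mlieBracket I X Y) Z x
      - pairing I g (VectorField.mlieBracket I X Z) Y x
      - pairing I g (VectorField.mlieBracket I Y Z) X x)

/-- `D` is geodesic: the component of `∇_X Y` in `D^⊥` vanishes for all sections `X`, `Y`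
of `D`. -/
def IsGeodesic (g : CovTensor I M) (D : Distribution I M) : Prop :=
  ∀ (x : M) (X Y Z : VField I M), IsSectionAt I D X x → IsSectionAt I D Y x →
    IsSectionAt I (orthogonal I g D) Z x → leviCivita I g X Y Z x = 0

/-- `D` is umbilical with mean curvature normal `N`: the component of `∇_X Y` in `D^⊥` is
`⟨X, Y⟩ N` for all sections `X`, `Y` of `D`. If `D` is non-degenerate of positive rank `m`, taking
the trace shows that `N` is `1 / m` times the trace of the second fundamental form. -/
def IsUmbilicalWith (g : CovTensor I M) (D : Distribution I M) (N : VField I M) : Prop :=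
  (∀ x : M, IsSectionAt I (orthogonal I g D) N x) ∧
  ∀ (x : M) (X Y Z : VField I M), IsSectionAt I D X x → IsSectionAt I D Y x →
    IsSectionAt I (orthogonal I g D) Z x →
    leviCivita I g X Y Z x = pairing I g X Y x * pairing I g N Z x

/-- `D` is spherical: it is umbilical and its mean curvature normal `N` is parallel along `D` for
the connection induced on `D^⊥`, that is, the component of `∇_X N` in `D^⊥` vanishes for all
sections `X` of `D`. -/
def IsSpherical (g : CovTensor I M) (D : Distribution I M) : Prop :=
  ∃ N : VField I M, IsUmbilicalWith I g D N ∧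
    ∀ (x : M) (X Z : VField I M), IsSectionAt I D X x → IsSectionAt I (orthogonal I g D) Z x →
      leviCivita I g X N Z x = 0

/-- `D` is a Killing distribution: a non-degenerate spherical distribution whose orthogonal
complement is geodesic. -/
structure IsKillingDistribution (g : CovTensor I M) (D : Distribution I M) : Prop where
  smooth : IsSmoothDistribution I D
  nondegenerate : IsNondegenerate I g D
  spherical : IsSpherical I g D
  geodesic : IsGeodesic I g (orthogonal I g D)

end Distributions

/-! ### Warped products -/

section Pushforward

variable {E : Type*} [NormedAddCommGroup E] [NormedSpace ℝ E]
  {H : Type*} [TopologicalSpace H] (I : ModelWithCorners ℝ E H)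
  {N : Type*} [TopologicalSpace N] [ChartedSpace H N]
  {E' : Type*} [NormedAddCommGroup E'] [NormedSpace ℝ E']
  {H' : Type*} [TopologicalSpace H'] (J : ModelWithCorners ℝ E' H')
  {M : Type*} [TopologicalSpace M] [ChartedSpace H' M]

/-- Push-forward by `φ` of a contravariant 2-tensor at the point `x`:
`(φ_* T)(p, q) = T(p ∘ dφ, q ∘ dφ)`. -/
def pushforward (φ : N → M) (x : N)
    (T : (TangentSpace I x →L[ℝ] ℝ) →L[ℝ] TangentSpace I x) :
    (TangentSpace J (φ x) →L[ℝ] ℝ) →L[ℝ] TangentSpace J (φ x) :=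
  (mfderiv I J φ x) ∘L T ∘L (ContinuousLinearMap.precomp ℝ (mfderiv I J φ x))

/-- Pull-back by `φ` to the point `x` of a covariant 2-tensor at `φ x`:
`(φ^* T)(v, w) = T(dφ v, dφ w)`. -/
def pullback (φ : N → M) (x : N)
    (T : TangentSpace J (φ x) →L[ℝ] TangentSpace J (φ x) →L[ℝ] ℝ) :
    TangentSpace I x →L[ℝ] TangentSpace I x →L[ℝ] ℝ :=
  (ContinuousLinearMap.precomp ℝ (mfderiv I J φ x)) ∘L T ∘L (mfderiv I J φ x)

end Pushforward

section WarpedProducts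

variable {EB : Type*} [NormedAddCommGroup EB] [NormedSpace ℝ EB]
  {HB : Type*} [TopologicalSpace HB] (IB : ModelWithCorners ℝ EB HB)
  {B : Type*} [TopologicalSpace B] [ChartedSpace HB B]
  {EF : Type*} [NormedAddCommGroup EF] [NormedSpace ℝ EF]
  {HF : Type*} [TopologicalSpace HF] (IF : ModelWithCorners ℝ EF HF)
  {F : Type*} [TopologicalSpace F] [ChartedSpace HF F]

/-- The lift to `B × F` of a contravariant 2-tensor field on `B`. -/
def liftBase (K : ContraTensor IB B) : ContraTensor (IB.prod IF) (B × F) := fun z ↦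
  pushforward IB (IB.prod IF) (fun b : B ↦ (b, z.2)) z.1 (K z.1)

/-- The lift to `B × F` of a contravariant 2-tensor field on `F`. -/
def liftFiber (K : ContraTensor IF F) : ContraTensor (IB.prod IF) (B × F) := fun z ↦
  pushforward IF (IB.prod IF) (fun y : F ↦ (z.1, y)) z.2 (K z.2)

/-- The warped product metric `π_B^* g_B + ρ² π_F^* g_F` on `B × F`. -/
def warpedMetric (gB : CovTensor IB B) (gF : CovTensor IF F) (ρ : B → ℝ) :
    CovTensor (IB.prod IF) (B × F) := fun z ↦
  pullback (IB.prod IF) IB Prod.fst z (gB z.1)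
    + (ρ z.1) ^ 2 • pullback (IB.prod IF) IF Prod.snd z (gF z.2)

variable {E : Type*} [NormedAddCommGroup E] [NormedSpace ℝ E]
  {H : Type*} [TopologicalSpace H] (I : ModelWithCorners ℝ E H)
  {M : Type*} [TopologicalSpace M] [ChartedSpace H M]

/-- `φ : B × F → M` exhibits the warped product `B ×_ρ F` of the pseudo-Riemannian manifolds
`(B, g_B)` and `(F, g_F)`, with `dim F > 0`, as a local warped product of `(M, g)` adapted to the
net `(D^⊥, D)`: `φ` is a diffeomorphism onto its open image and an isometry onto it, and maps the
slices `B × {y}` to integral manifolds of `D^⊥` and the slices `{b} × F` to integral manifolds of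
`D`. -/
structure IsAdaptedWarpedProduct [IsManifold IB ∞ B] [IsManifold IF ∞ F] (g : CovTensor I M)
    (D : Distribution I M) (gB : CovTensor IB B) (gF : CovTensor IF F) (ρ : B → ℝ)
    (φ : B × F → M) : Prop where
  metric_base : IsPseudoRiemannianMetric IB gB
  metric_fiber : IsPseudoRiemannianMetric IF gF
  fiber_dim_pos : 0 < Module.finrank ℝ EF
  warp_smooth : ContMDiff IB 𝓘(ℝ, ℝ) ∞ ρ
  warp_pos : ∀ b, 0 < ρ b
  injective : Function.Injective φ
  localDiffeo : IsLocalDiffeomorph (IB.prod IF) I ∞ φ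
  isometry : ∀ z : B × F,
    pullback (IB.prod IF) I φ z (g (φ z)) = warpedMetric IB IF gB gF ρ z
  adapted_base : ∀ (b : B) (y : F),
    (mfderiv IB I (fun b' : B ↦ φ (b', y)) b).range = orthogonal I g D (φ (b, y))
  adapted_fiber : ∀ (b : B) (y : F),
    (mfderiv IF I (fun y' : F ↦ φ (b, y')) y).range = D (φ (b, y))

end WarpedProducts

end WarpedKilling

end

noncomputable section

namespace WarpedKilling

/-!
The value of the Schouten bracket `[K, G]` at a point depends only on the differentials of the
three functions it is evaluated on, and `K` is block diagonal because `D` is `K`-invariant. On the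
product the bracket can therefore be tested on functions of one factor only, which leaves four
kinds of components. Those of type `BBB` and `FFF` vanish iff the blocks of `K` along the slices
are Killing tensors of the factors. Those of type `FBB` vanish iff the base block `K'` does not
depend on the point of `F`. Those of type `BFF` vanish iff the derivative along `B` of the fiber
block is `K' dκ ⊗ G₁`. Since `G₁ ≠ 0`, the last equation makes `K' dκ` the differential of a
function `t`, and then the fiber block minus `t G₁` does not depend on the point of `B`.
-/

/-! ### Smooth maps into finite-dimensional spaces -/

section NormedSpace

variable {E : Type*} [NormedAddCommGroup E] [NormedSpace ℝ E]
  {H : Type*} [TopologicalSpace H] {I : ModelWithCorners ℝ E H}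
  {M : Type*} [TopologicalSpace M] [ChartedSpace H M]
  {V W : Type*} [NormedAddCommGroup V] [NormedSpace ℝ V] [NormedAddCommGroup W] [NormedSpace ℝ W]
  {x : M}

theorem contMDiffAt_of_forall_dual [FiniteDimensional ℝ W] {n : WithTop ℕ∞} {f : M → W}
    (hf : ∀ p : W →L[ℝ] ℝ, CMDiffAt n (fun y ↦ p (f y)) x) : CMDiffAt n f x := by
  let b := Module.finBasis ℝ W
  have hfb : f = fun y ↦ ∑ i, LinearMap.toContinuousLinearMap (b.coord i) (f y) • b i :=
    funext fun y ↦ (b.sum_repr (f y)).symm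
  rw [hfb]
  exact contMDiffAt_finsetSum fun i _ ↦ (hf _).smul contMDiffAt_const

theorem contMDiffAt_clm_of_forall_apply [FiniteDimensional ℝ V] {n : WithTop ℕ∞}
    {f : M → V →L[ℝ] W} (hf : ∀ v, CMDiffAt n (fun y ↦ f y v) x) : CMDiffAt n f x := by
  let b := Module.finBasis ℝ V
  have hfb : f = fun y ↦ ∑ i, ContinuousLinearMap.smulRightL ℝ V W
      (LinearMap.toContinuousLinearMap (b.coord i)) (f y (b i)) := by
    ext y v
    conv_lhs => rw [← b.sum_repr v, map_sum]
    simp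
  rw [hfb]
  exact contMDiffAt_finsetSum fun i _ ↦
    (ContinuousLinearMap.smulRightL ℝ V W _).contMDiff.contMDiffAt.comp x (hf (b i))

theorem mvfderiv_congr_of_eventuallyEq {f h : M → W} (hfh : f =ᶠ[𝓝 x] h) :
    d% f x = d% h x := by
  have : mfderiv% f x = mfderiv% h x := hfh.mfderiv_eq
  exact this

theorem mvfderiv_clm_apply {A : M → V →L[ℝ] W} {s : M → V} (hA : MDiffAt A x) (hs : MDiffAt s x)
    (v : TangentSpace I x) :
    d% (fun y ↦ A y (s y)) x v = d% A x v (s x) + A x (d% s x v) := by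
  have happly := (isBoundedBilinearMap_apply (𝕜 := ℝ) (E := V) (F := W)).hasFDerivAt (A x, s x)
  have hprod : HasMFDerivAt I 𝓘(ℝ, (V →L[ℝ] W) × V) (fun y ↦ (A y, s y)) x
      ((d% A x).prod (d% s x)) :=
    ⟨hA.continuousAt.prodMk hs.continuousAt, hA.hasMFDerivAt.2.prodMk hs.hasMFDerivAt.2⟩
  have hcomp := congrArg (· v) (happly.hasMFDerivAt.comp x hprod).mfderiv
  refine hcomp.trans ?_
  exact add_comm _ _

theorem eventually_mdifferentiableAt
    {E' : Type*} [NormedAddCommGroup E'] [NormedSpace ℝ E'] {H' : Type*} [TopologicalSpace H']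
    {J : ModelWithCorners ℝ E' H'} {N : Type*} [TopologicalSpace N] [ChartedSpace H' N]
    [IsManifold I 1 M] [IsManifold J 1 N] {f : M → N} (hf : CMDiffAt ∞ f x) :
    ∀ᶠ y in 𝓝 x, MDiffAt f y := by
  filter_upwards [(contMDiffAt_iff_contMDiffAt_nhds (by simp)).1
    (hf.of_le (by simp : (1 : WithTop ℕ∞) ≤ ∞))] with y hy
  exact hy.mdifferentiableAt one_ne_zero

end NormedSpace

/-! ### Reading functions in a chart -/

section Chart

variable {E : Type*} [NormedAddCommGroup E] [NormedSpace ℝ E]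
  {H : Type*} [TopologicalSpace H] (I : ModelWithCorners ℝ E H)
  {M : Type*} [TopologicalSpace M] [ChartedSpace H M]

/-- The differential at `y` of the extended chart at `x₀`. -/
def chartDiff (x₀ y : M) : TangentSpace I y →L[ℝ] E := mvfderiv I (extChartAt I x₀) y

/-- The derivative at `y` of `f` read in the extended chart at `x₀`. The derivative is taken in the
model space `E`, so it varies in a fixed space of linear forms. -/
def chartDeriv (x₀ : M) (f : M → ℝ) (y : M) : E →L[ℝ] ℝ :=
  fderiv ℝ (f ∘ (extChartAt I x₀).symm) (extChartAt I x₀ y)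

/-- The Hessian at `x` of `f` read in the extended chart at `x`. It depends on the chart unless
`x` is a critical point of `f`. -/
def chartHessian (f : M → ℝ) (x : M) (v w : TangentSpace I x) : ℝ :=
  fderiv ℝ (fderiv ℝ (f ∘ (extChartAt I x).symm)) (extChartAt I x x)
    (chartDiff I x x v) (chartDiff I x x w)

variable {I} {x : M} {f : M → ℝ}

section Boundaryless

variable [I.Boundaryless]

theorem contDiffAt_comp_extChartAt_symm (hf : CMDiffAt ∞ f x) :
    ContDiffAt ℝ ∞ (f ∘ (extChartAt I x).symm) (extChartAt I x x) := by
  simpa [I.range_eq_univ, contDiffWithinAt_univ] using! (contMDiffAt_iff.1 hf).2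

theorem contMDiffAt_chartDeriv (hf : CMDiffAt ∞ f x) : CMDiffAt ∞ (chartDeriv I x f) x :=
  ((contDiffAt_comp_extChartAt_symm hf).fderiv_right (m := ∞) (by simp)).contMDiffAt.comp x
    contMDiffAt_extChartAt

theorem chartHessian_comm (hf : CMDiffAt ∞ f x) (v w : TangentSpace I x) :
    chartHessian I f x v w = chartHessian I f x w v :=
  (contDiffAt_comp_extChartAt_symm hf).isSymmSndFDerivAt
    (by simpa using! (WithTop.coe_le_coe.2 le_top : ((2 : ℕ∞) : WithTop ℕ∞) ≤ ∞)) _ _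

end Boundaryless

variable [IsManifold I ∞ M]

theorem isInvertible_chartDiff {x₀ y : M} (hy : y ∈ (extChartAt I x₀).source) :
    (chartDiff I x₀ y).IsInvertible := by
  obtain ⟨A, hA⟩ := isInvertible_mfderiv_extChartAt (I := I) hy
  exact ⟨A, hA⟩

theorem contMDiffAt_functional_comp_extChartAt {x₀ y : M} (hy : y ∈ (extChartAt I x₀).source)
    (p : E →L[ℝ] ℝ) : CMDiffAt ∞ (p ∘ extChartAt I x₀) y :=
  p.contMDiff.contMDiffAt.comp y (contMDiffAt_extChartAt' (by simpa using hy))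

theorem mvfderiv_functional_comp_extChartAt {x₀ y : M} (hy : y ∈ (extChartAt I x₀).source)
    (p : E →L[ℝ] ℝ) : d% (p ∘ extChartAt I x₀) y = p ∘L chartDiff I x₀ y := by
  have hcomp := mfderiv_comp y p.mdifferentiableAt
    (mdifferentiableAt_extChartAt (I := I) (x := x₀) (by simpa using hy))
  rw [p.mfderiv_eq] at hcomp
  exact hcomp

theorem exists_mvfderiv_eq (x : M) (q : TangentSpace I x →L[ℝ] ℝ) :
    ∃ f : M → ℝ, CMDiffAt ∞ f x ∧ d% f x = q := by
  obtain ⟨A, hA⟩ := isInvertible_chartDiff (mem_extChartAt_source (I := I) x)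
  refine ⟨(q ∘L (A.symm : E →L[ℝ] TangentSpace I x)) ∘ extChartAt I x,
    contMDiffAt_functional_comp_extChartAt (mem_extChartAt_source x) _, ?_⟩
  rw [mvfderiv_functional_comp_extChartAt (mem_extChartAt_source x), ← hA]
  ext v
  simp

variable [I.Boundaryless]

theorem mvfderiv_eventuallyEq_chartDeriv (hf : CMDiffAt ∞ f x) :
    ∀ᶠ y in 𝓝 x, d% f y = chartDeriv I x f y ∘L chartDiff I x y := by
  have hdiff : ∀ᶠ e in 𝓝 (extChartAt I x x), DifferentiableAt ℝ (f ∘ (extChartAt I x).symm) e := by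
    filter_upwards [((contDiffAt_comp_extChartAt_symm hf).of_le
      (by simp : (1 : WithTop ℕ∞) ≤ ∞)).eventually (by simp)] with e he
    exact he.differentiableAt one_ne_zero
  filter_upwards [(continuousAt_extChartAt x).eventually hdiff,
    eventually_eventually_nhds.2 (extChartAt_source_mem_nhds (I := I) x)] with y hdy hsource
  have hy : y ∈ (chartAt H x).source := by
    rw [← extChartAt_source I]
    exact hsource.self_of_nhds
  have hfy : f =ᶠ[𝓝 y] (f ∘ (extChartAt I x).symm) ∘ extChartAt I x := by
    filter_upwards [hsource] with z hz
    exact congrArg f ((extChartAt I x).left_inv hz).symm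
  have hcomp := mfderiv_comp y hdy.mdifferentiableAt (mdifferentiableAt_extChartAt (I := I) hy)
  rw [mfderiv_eq_fderiv] at hcomp
  exact (mvfderiv_congr_of_eventuallyEq hfy).trans hcomp

theorem mvfderiv_chartDeriv_apply (hf : CMDiffAt ∞ f x) (v w : TangentSpace I x) :
    d% (chartDeriv I x f) x v (chartDiff I x x w) = chartHessian I f x v w := by
  have hdiff : DifferentiableAt ℝ (fderiv ℝ (f ∘ (extChartAt I x).symm)) (extChartAt I x x) :=
    ((contDiffAt_comp_extChartAt_symm hf).fderiv_right (m := ∞) (by simp)).differentiableAt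
      (by simp)
  have hcomp := mfderiv_comp x hdiff.mdifferentiableAt
    (mdifferentiableAt_extChartAt (I := I) (mem_chart_source H x))
  rw [mfderiv_eq_fderiv] at hcomp
  exact congrArg (fun A : TangentSpace I x →L[ℝ] E →L[ℝ] ℝ ↦ A v (chartDiff I x x w)) hcomp

theorem chartDeriv_eq_zero (hf : CMDiffAt ∞ f x) (hcrit : d% f x = 0) :
    chartDeriv I x f x = 0 := by
  obtain ⟨A, hA⟩ := isInvertible_chartDiff (mem_extChartAt_source (I := I) x)
  have hchart := (mvfderiv_eventuallyEq_chartDeriv hf).self_of_nhds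
  rw [hcrit, ← hA] at hchart
  ext w
  simpa using (congrArg (· (A.symm w)) hchart).symm

end Chart

/-! ### Contractions and the Schouten bracket -/

section Schouten

variable {E : Type*} [NormedAddCommGroup E] [NormedSpace ℝ E]
  {H : Type*} [TopologicalSpace H] (I : ModelWithCorners ℝ E H)
  {M : Type*} [TopologicalSpace M] [ChartedSpace H M]

/-- The function `T(df, dh)`. -/
def contraction (T : ContraTensor I M) (f h : M → ℝ) : M → ℝ :=
  fun y ↦ mvfderiv I f y (T y (mvfderiv I h y))

/-- One of the three terms in the cyclic sum defining the Schouten bracket. -/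
def schoutenTerm (K G : ContraTensor I M) (u f h : M → ℝ) (x : M) : ℝ :=
  mvfderiv I (contraction I G f h) x (K x (mvfderiv I u x))
    - mvfderiv I (contraction I K f h) x (G x (mvfderiv I u x))

/-- The tensor field `T` read in the extended chart at `x₀`. -/
def tensorInChart (T : ContraTensor I M) (x₀ y : M) : (E →L[ℝ] ℝ) →L[ℝ] E :=
  chartDiff I x₀ y ∘L T y ∘L ContinuousLinearMap.precomp ℝ (chartDiff I x₀ y)

variable {I} {K G T : ContraTensor I M} {x : M} {f f' f₁ f₂ f₃ h : M → ℝ}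

theorem schouten_eq_sum_schoutenTerm (K G : ContraTensor I M) (f₁ f₂ f₃ : M → ℝ) (x : M) :
    schouten I K G f₁ f₂ f₃ x = (2 / 3 : ℝ) * (schoutenTerm I K G f₁ f₂ f₃ x
      + schoutenTerm I K G f₂ f₃ f₁ x + schoutenTerm I K G f₃ f₁ f₂ x) := rfl

theorem schouten_cycle (K G : ContraTensor I M) (f₁ f₂ f₃ : M → ℝ) (x : M) :
    schouten I K G f₁ f₂ f₃ x = schouten I K G f₂ f₃ f₁ x := by
  simp only [schouten_eq_sum_schoutenTerm]
  ring

theorem IsSymmetricTensorField.contMDiffAt (hT : IsSymmetricTensorField I T)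
    (hf : CMDiffAt ∞ f x) (hh : CMDiffAt ∞ h x) : CMDiffAt ∞ (contraction I T f h) x :=
  hT.smooth x f h hf hh

theorem IsSymmetricTensorField.mdifferentiableAt (hT : IsSymmetricTensorField I T)
    (hf : CMDiffAt ∞ f x) (hh : CMDiffAt ∞ h x) : MDiffAt (contraction I T f h) x :=
  (hT.contMDiffAt hf hh).mdifferentiableAt (by simp)

theorem IsSymmetricTensorField.contraction_comm (hT : IsSymmetricTensorField I T) (f h : M → ℝ) :
    contraction I T f h = contraction I T h f :=
  funext fun y ↦ hT.symm y _ _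

variable [IsManifold I ∞ M]

theorem tensor_ext {T S : (TangentSpace I x →L[ℝ] ℝ) →L[ℝ] TangentSpace I x}
    (hTS : ∀ f h : M → ℝ, CMDiffAt ∞ f x → CMDiffAt ∞ h x →
      d% f x (T (d% h x)) = d% f x (S (d% h x))) : T = S := by
  ext q
  refine (SeparatingDual.eq_iff_forall_dual_eq (R := ℝ) (V := E)).2 fun p ↦ ?_
  obtain ⟨f, hf, rfl⟩ := exists_mvfderiv_eq (I := I) x p
  obtain ⟨h, hh, rfl⟩ := exists_mvfderiv_eq (I := I) x q
  exact hTS f h hf hh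

theorem apply_tensorInChart_apply (T : ContraTensor I M) {x₀ y : M}
    (hy : y ∈ (extChartAt I x₀).source) (p q : E →L[ℝ] ℝ) :
    p (tensorInChart I T x₀ y q) =
      contraction I T (p ∘ extChartAt I x₀) (q ∘ extChartAt I x₀) y := by
  rw [contraction, mvfderiv_functional_comp_extChartAt hy, mvfderiv_functional_comp_extChartAt hy]
  rfl

theorem contMDiffAt_tensorInChart [FiniteDimensional ℝ E]
    (hT : ∀ p q : E →L[ℝ] ℝ,
      CMDiffAt ∞ (contraction I T (p ∘ extChartAt I x) (q ∘ extChartAt I x)) x) :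
    CMDiffAt ∞ (tensorInChart I T x) x := by
  refine contMDiffAt_clm_of_forall_apply fun q ↦ contMDiffAt_of_forall_dual fun p ↦
    (hT p q).congr_of_eventuallyEq ?_
  filter_upwards [extChartAt_source_mem_nhds (I := I) x] with y hy
  exact apply_tensorInChart_apply T hy p q

theorem IsSymmetricTensorField.contMDiffAt_tensorInChart [FiniteDimensional ℝ E]
    (hT : IsSymmetricTensorField I T) (x : M) : CMDiffAt ∞ (tensorInChart I T x) x :=
  WarpedKilling.contMDiffAt_tensorInChart fun p q ↦
    hT.contMDiffAt (contMDiffAt_functional_comp_extChartAt (mem_extChartAt_source x) p)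
      (contMDiffAt_functional_comp_extChartAt (mem_extChartAt_source x) q)

theorem contraction_add_left_eventuallyEq (T : ContraTensor I M) (h : M → ℝ)
    (hf : CMDiffAt ∞ f x) (hf' : CMDiffAt ∞ f' x) :
    contraction I T (f + f') h =ᶠ[𝓝 x] contraction I T f h + contraction I T f' h := by
  filter_upwards [eventually_mdifferentiableAt hf, eventually_mdifferentiableAt hf'] with y hfy hfy'
  simp [contraction, mvfderiv_add hfy hfy']

theorem IsSymmetricTensorField.mvfderiv_contraction_add_left (hT : IsSymmetricTensorField I T)
    (hf : CMDiffAt ∞ f x) (hf' : CMDiffAt ∞ f' x) (hh : CMDiffAt ∞ h x) :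
    d% (contraction I T (f + f') h) x =
      d% (contraction I T f h) x + d% (contraction I T f' h) x := by
  rw [mvfderiv_congr_of_eventuallyEq (contraction_add_left_eventuallyEq T h hf hf'),
    mvfderiv_add (hT.mdifferentiableAt hf hh) (hT.mdifferentiableAt hf' hh)]

theorem schouten_add_left (hK : IsSymmetricTensorField I K) (hG : IsSymmetricTensorField I G)
    (hf : CMDiffAt ∞ f x) (hf' : CMDiffAt ∞ f' x) (hf₂ : CMDiffAt ∞ f₂ x) (hf₃ : CMDiffAt ∞ f₃ x) :
    schouten I K G (f + f') f₂ f₃ x = schouten I K G f f₂ f₃ x + schouten I K G f' f₂ f₃ x := by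
  simp only [schouten_eq_sum_schoutenTerm, schoutenTerm, hK.contraction_comm f₃,
    hG.contraction_comm f₃, hK.mvfderiv_contraction_add_left hf hf' hf₂,
    hK.mvfderiv_contraction_add_left hf hf' hf₃, hG.mvfderiv_contraction_add_left hf hf' hf₂,
    hG.mvfderiv_contraction_add_left hf hf' hf₃,
    mvfderiv_add (hf.mdifferentiableAt (by simp)) (hf'.mdifferentiableAt (by simp)), map_add,
    add_apply]
  ring

variable [I.Boundaryless]

theorem contraction_eventuallyEq_tensorInChart (T : ContraTensor I M)
    (hf : CMDiffAt ∞ f x) (hh : CMDiffAt ∞ h x) :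
    contraction I T f h =ᶠ[𝓝 x]
      fun y ↦ chartDeriv I x f y (tensorInChart I T x y (chartDeriv I x h y)) := by
  filter_upwards [mvfderiv_eventuallyEq_chartDeriv hf, mvfderiv_eventuallyEq_chartDeriv hh]
    with y hfy hhy
  rw [contraction, hfy, hhy]
  rfl

theorem contMDiffAt_contraction_of_tensorInChart (hT : CMDiffAt ∞ (tensorInChart I T x) x)
    (hf : CMDiffAt ∞ f x) (hh : CMDiffAt ∞ h x) : CMDiffAt ∞ (contraction I T f h) x :=
  ((contMDiffAt_chartDeriv hf).clm_apply (hT.clm_apply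
    (contMDiffAt_chartDeriv hh))).congr_of_eventuallyEq
      (contraction_eventuallyEq_tensorInChart T hf hh)

variable [FiniteDimensional ℝ E]

theorem IsSymmetricTensorField.mvfderiv_contraction_of_mvfderiv_eq_zero
    (hT : IsSymmetricTensorField I T) (hf : CMDiffAt ∞ f x) (hh : CMDiffAt ∞ h x)
    (hcrit : d% f x = 0) (v : TangentSpace I x) :
    d% (contraction I T f h) x v = chartHessian I f x v (T x (d% h x)) := by
  have hs : CMDiffAt ∞ (fun y ↦ tensorInChart I T x y (chartDeriv I x h y)) x :=
    (hT.contMDiffAt_tensorInChart x).clm_apply (contMDiffAt_chartDeriv hh)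
  rw [mvfderiv_congr_of_eventuallyEq (contraction_eventuallyEq_tensorInChart T hf hh),
    mvfderiv_clm_apply ((contMDiffAt_chartDeriv hf).mdifferentiableAt (by simp))
      (hs.mdifferentiableAt (by simp)),
    chartDeriv_eq_zero hf hcrit, zero_apply, add_zero, ← mvfderiv_chartDeriv_apply hf,
    (mvfderiv_eventuallyEq_chartDeriv hh).self_of_nhds]
  rfl

-- The four second-derivative terms cancel in pairs, by symmetry of the Hessian of `f₁`.
theorem schouten_eq_zero_of_mvfderiv_eq_zero (hK : IsSymmetricTensorField I K)
    (hG : IsSymmetricTensorField I G) (hf₁ : CMDiffAt ∞ f₁ x) (hf₂ : CMDiffAt ∞ f₂ x)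
    (hf₃ : CMDiffAt ∞ f₃ x) (hcrit : d% f₁ x = 0) : schouten I K G f₁ f₂ f₃ x = 0 := by
  simp only [schouten_eq_sum_schoutenTerm, schoutenTerm, hK.contraction_comm f₃,
    hG.contraction_comm f₃, hK.mvfderiv_contraction_of_mvfderiv_eq_zero hf₁ hf₂ hcrit,
    hK.mvfderiv_contraction_of_mvfderiv_eq_zero hf₁ hf₃ hcrit,
    hG.mvfderiv_contraction_of_mvfderiv_eq_zero hf₁ hf₂ hcrit,
    hG.mvfderiv_contraction_of_mvfderiv_eq_zero hf₁ hf₃ hcrit, hcrit, map_zero]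
  rw [chartHessian_comm hf₁ (K x (d% f₂ x)), chartHessian_comm hf₁ (G x (d% f₂ x))]
  ring

theorem schouten_congr_left (hK : IsSymmetricTensorField I K) (hG : IsSymmetricTensorField I G)
    (hf : CMDiffAt ∞ f x) (hf' : CMDiffAt ∞ f' x) (hf₂ : CMDiffAt ∞ f₂ x) (hf₃ : CMDiffAt ∞ f₃ x)
    (hff' : d% f x = d% f' x) : schouten I K G f f₂ f₃ x = schouten I K G f' f₂ f₃ x := by
  have hsub : CMDiffAt ∞ (f - f') x := hf.sub hf'
  have hcrit : d% (f - f') x = 0 := by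
    rw [mvfderiv_sub (hf.mdifferentiableAt (by simp)) (hf'.mdifferentiableAt (by simp)), hff',
      sub_self]
  simpa [schouten_eq_zero_of_mvfderiv_eq_zero hK hG hsub hf₂ hf₃ hcrit] using
    schouten_add_left hK hG hf' hsub hf₂ hf₃

end Schouten

/-! ### Linearity of the Schouten bracket in the tensor fields -/

section Linearity

variable {E : Type*} [NormedAddCommGroup E] [NormedSpace ℝ E]
  {H : Type*} [TopologicalSpace H] {I : ModelWithCorners ℝ E H}
  {M : Type*} [TopologicalSpace M] [ChartedSpace H M]
  {K K' G : ContraTensor I M} {x : M} {f₁ f₂ f₃ : M → ℝ}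

theorem mvfderiv_const_smul {f : M → ℝ} (hf : MDiffAt f x) (c : ℝ) :
    d% (c • f) x = c • d% f x :=
  (hf.hasMFDerivAt.const_smul c).mfderiv

theorem contraction_add (T S : ContraTensor I M) (f h : M → ℝ) :
    contraction I (T + S) f h = contraction I T f h + contraction I S f h :=
  funext fun x ↦ map_add (d% f x) _ _

theorem contraction_const_smul (c : ℝ) (T : ContraTensor I M) (f h : M → ℝ) :
    contraction I (c • T) f h = c • contraction I T f h :=
  funext fun x ↦ map_smul (d% f x) c _

theorem IsSymmetricTensorField.const_smul (hK : IsSymmetricTensorField I K) (c : ℝ) :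
    IsSymmetricTensorField I (c • K) where
  symm x p q := by
    simp only [Pi.smul_apply, smul_apply, map_smul, hK.symm x p q]
  smooth x f h hf hh := by
    change CMDiffAt ∞ (contraction I (c • K) f h) x
    rw [contraction_const_smul]
    exact (contMDiffAt_const (c := c)).mul (hK.contMDiffAt hf hh)

theorem schouten_swap (K G : ContraTensor I M) (f₁ f₂ f₃ : M → ℝ) (x : M) :
    schouten I K G f₁ f₂ f₃ x = -schouten I G K f₁ f₂ f₃ x := by
  simp only [schouten_eq_sum_schoutenTerm, schoutenTerm]
  ring

theorem schouten_self (G : ContraTensor I M) (f₁ f₂ f₃ : M → ℝ) (x : M) :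
    schouten I G G f₁ f₂ f₃ x = 0 := by
  linarith [schouten_swap G G f₁ f₂ f₃ x]

theorem schouten_zero (G : ContraTensor I M) (f₁ f₂ f₃ : M → ℝ) (x : M) :
    schouten I 0 G f₁ f₂ f₃ x = 0 := by
  have hzero (f h : M → ℝ) : contraction I 0 f h = 0 := funext fun x ↦ map_zero (d% f x)
  simp [schouten_eq_sum_schoutenTerm, schoutenTerm, hzero, mvfderiv_zero]

theorem schouten_add (hK : IsSymmetricTensorField I K) (hK' : IsSymmetricTensorField I K')
    (hf₁ : CMDiffAt ∞ f₁ x) (hf₂ : CMDiffAt ∞ f₂ x) (hf₃ : CMDiffAt ∞ f₃ x) :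
    schouten I (K + K') G f₁ f₂ f₃ x =
      schouten I K G f₁ f₂ f₃ x + schouten I K' G f₁ f₂ f₃ x := by
  simp only [schouten_eq_sum_schoutenTerm, schoutenTerm, contraction_add]
  rw [mvfderiv_add (hK.mdifferentiableAt hf₂ hf₃) (hK'.mdifferentiableAt hf₂ hf₃),
    mvfderiv_add (hK.mdifferentiableAt hf₃ hf₁) (hK'.mdifferentiableAt hf₃ hf₁),
    mvfderiv_add (hK.mdifferentiableAt hf₁ hf₂) (hK'.mdifferentiableAt hf₁ hf₂)]
  simp only [Pi.add_apply, add_apply, map_add]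
  ring

theorem schouten_const_smul_right (hG : IsSymmetricTensorField I G) (c : ℝ)
    (hf₁ : CMDiffAt ∞ f₁ x) (hf₂ : CMDiffAt ∞ f₂ x) (hf₃ : CMDiffAt ∞ f₃ x) :
    schouten I K (c • G) f₁ f₂ f₃ x = c * schouten I K G f₁ f₂ f₃ x := by
  simp only [schouten_eq_sum_schoutenTerm, schoutenTerm, contraction_const_smul]
  rw [mvfderiv_const_smul (hG.mdifferentiableAt hf₂ hf₃),
    mvfderiv_const_smul (hG.mdifferentiableAt hf₃ hf₁),
    mvfderiv_const_smul (hG.mdifferentiableAt hf₁ hf₂)]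
  simp only [Pi.smul_apply, smul_apply, map_smul, smul_eq_mul]
  ring

theorem schouten_const_smul_left (hK : IsSymmetricTensorField I K) (c : ℝ)
    (hf₁ : CMDiffAt ∞ f₁ x) (hf₂ : CMDiffAt ∞ f₂ x) (hf₃ : CMDiffAt ∞ f₃ x) :
    schouten I (c • K) G f₁ f₂ f₃ x = c * schouten I K G f₁ f₂ f₃ x := by
  rw [schouten_swap, schouten_const_smul_right hK c hf₁ hf₂ hf₃, schouten_swap G K, mul_neg,
    neg_neg]

end Linearity

/-! ### Naturality of the Schouten bracket -/

section Naturality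

variable {E : Type*} [NormedAddCommGroup E] [NormedSpace ℝ E]
  {H : Type*} [TopologicalSpace H] {I : ModelWithCorners ℝ E H}
  {N : Type*} [TopologicalSpace N] [ChartedSpace H N]
  {E' : Type*} [NormedAddCommGroup E'] [NormedSpace ℝ E']
  {H' : Type*} [TopologicalSpace H'] {J : ModelWithCorners ℝ E' H'}
  {M : Type*} [TopologicalSpace M] [ChartedSpace H' M]
  {φ : N → M} {z : N} {K G T : ContraTensor I N} {K' G' S : ContraTensor J M}
  {u f h f₁ f₂ f₃ : M → ℝ}

theorem contraction_comp_of_pushforward (hTS : S (φ z) = pushforward I J φ z (T z))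
    (hφ : MDiffAt φ z) (hf : MDiffAt f (φ z)) (hh : MDiffAt h (φ z)) :
    contraction J S f h (φ z) = contraction I T (f ∘ φ) (h ∘ φ) z := by
  rw [contraction, contraction, mvfderiv_comp z hf hφ, mvfderiv_comp z hh hφ, hTS]
  rfl

variable [IsManifold I ∞ N] [IsManifold J ∞ M]

theorem contraction_comp_eventuallyEq_of_pushforward
    (hTS : ∀ᶠ y in 𝓝 z, S (φ y) = pushforward I J φ y (T y)) (hφ : CMDiffAt ∞ φ z)
    (hf : CMDiffAt ∞ f (φ z)) (hh : CMDiffAt ∞ h (φ z)) :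
    contraction J S f h ∘ φ =ᶠ[𝓝 z] contraction I T (f ∘ φ) (h ∘ φ) := by
  filter_upwards [hTS, eventually_mdifferentiableAt hφ,
    hφ.continuousAt.eventually (eventually_mdifferentiableAt hf),
    hφ.continuousAt.eventually (eventually_mdifferentiableAt hh)] with y hTSy hφy hfy hhy
  exact contraction_comp_of_pushforward hTSy hφy hfy hhy

theorem mvfderiv_contraction_of_pushforward
    (hTS : ∀ᶠ y in 𝓝 z, S (φ y) = pushforward I J φ y (T y)) (hφ : CMDiffAt ∞ φ z)
    (hS : IsSymmetricTensorField J S) (hf : CMDiffAt ∞ f (φ z)) (hh : CMDiffAt ∞ h (φ z)) :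
    d% (contraction I T (f ∘ φ) (h ∘ φ)) z = d% (contraction J S f h) (φ z) ∘L mfderiv I J φ z := by
  rw [← mvfderiv_congr_of_eventuallyEq (contraction_comp_eventuallyEq_of_pushforward hTS hφ hf hh)]
  exact mvfderiv_comp z (hS.mdifferentiableAt hf hh) (hφ.mdifferentiableAt (by simp))

theorem schoutenTerm_comp_of_pushforward
    (hK : ∀ᶠ y in 𝓝 z, K' (φ y) = pushforward I J φ y (K y))
    (hG : ∀ᶠ y in 𝓝 z, G' (φ y) = pushforward I J φ y (G y)) (hφ : CMDiffAt ∞ φ z)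
    (hK' : IsSymmetricTensorField J K') (hG' : IsSymmetricTensorField J G')
    (hu : CMDiffAt ∞ u (φ z)) (hf : CMDiffAt ∞ f (φ z)) (hh : CMDiffAt ∞ h (φ z)) :
    schoutenTerm J K' G' u f h (φ z) = schoutenTerm I K G (u ∘ φ) (f ∘ φ) (h ∘ φ) z := by
  rw [schoutenTerm, schoutenTerm, mvfderiv_contraction_of_pushforward hK hφ hK' hf hh,
    mvfderiv_contraction_of_pushforward hG hφ hG' hf hh,
    mvfderiv_comp z (hu.mdifferentiableAt (by simp)) (hφ.mdifferentiableAt (by simp)),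
    hK.self_of_nhds, hG.self_of_nhds]
  rfl

theorem schouten_comp_of_pushforward
    (hK : ∀ᶠ y in 𝓝 z, K' (φ y) = pushforward I J φ y (K y))
    (hG : ∀ᶠ y in 𝓝 z, G' (φ y) = pushforward I J φ y (G y)) (hφ : CMDiffAt ∞ φ z)
    (hK' : IsSymmetricTensorField J K') (hG' : IsSymmetricTensorField J G')
    (hf₁ : CMDiffAt ∞ f₁ (φ z)) (hf₂ : CMDiffAt ∞ f₂ (φ z)) (hf₃ : CMDiffAt ∞ f₃ (φ z)) :
    schouten J K' G' f₁ f₂ f₃ (φ z) = schouten I K G (f₁ ∘ φ) (f₂ ∘ φ) (f₃ ∘ φ) z := by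
  rw [schouten_eq_sum_schoutenTerm, schouten_eq_sum_schoutenTerm,
    schoutenTerm_comp_of_pushforward hK hG hφ hK' hG' hf₁ hf₂ hf₃,
    schoutenTerm_comp_of_pushforward hK hG hφ hK' hG' hf₂ hf₃ hf₁,
    schoutenTerm_comp_of_pushforward hK hG hφ hK' hG' hf₃ hf₁ hf₂]

end Naturality

/-! ### Functions with vanishing differential -/

section Constant

variable {E : Type*} [NormedAddCommGroup E] [NormedSpace ℝ E]
  {H : Type*} [TopologicalSpace H] {I : ModelWithCorners ℝ E H} [I.Boundaryless]
  {M : Type*} [TopologicalSpace M] [ChartedSpace H M] [IsManifold I 1 M] {f : M → ℝ}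

theorem hasFDerivAt_comp_extChartAt_symm_of_mvfderiv_eq_zero (hf : MDiff f)
    (hcrit : ∀ x, d% f x = 0) {x : M} {e : E} (he : e ∈ (extChartAt I x).target) :
    HasFDerivAt (f ∘ (extChartAt I x).symm) (0 : E →L[ℝ] ℝ) e := by
  have hsymm : MDifferentiableAt 𝓘(ℝ, E) I (extChartAt I x).symm e := by
    rw [← mdifferentiableWithinAt_univ, ← I.range_eq_univ]
    exact mdifferentiableWithinAt_extChartAt_symm he
  have hcomp := mvfderiv_comp e (hf _) hsymm
  rw [hcrit, ContinuousLinearMap.zero_comp] at hcomp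
  rw [show (0 : E →L[ℝ] ℝ) = fderiv ℝ (f ∘ (extChartAt I x).symm) e from
    hcomp.symm.trans mfderiv_eq_fderiv]
  exact ((hf _).comp e hsymm).differentiableAt.hasFDerivAt

theorem isLocallyConstant_of_mvfderiv_eq_zero (hf : MDiff f) (hcrit : ∀ x, d% f x = 0) :
    IsLocallyConstant f := by
  refine (IsLocallyConstant.iff_eventually_eq f).2 fun x ↦ ?_
  obtain ⟨r, hr, hball⟩ := Metric.mem_nhds_iff.1 (extChartAt_target_mem_nhds (I := I) x)
  filter_upwards [extChartAt_source_mem_nhds (I := I) x,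
    (continuousAt_extChartAt (I := I) x).eventually (Metric.ball_mem_nhds _ hr)] with y hy hyr
  have hder := fun e (he : e ∈ Metric.ball (extChartAt I x x) r) ↦
    hasFDerivAt_comp_extChartAt_symm_of_mvfderiv_eq_zero hf hcrit (hball he)
  have hconst := Metric.isOpen_ball.is_const_of_fderiv_eq_zero (convex_ball _ _).isPreconnected
    (fun e he ↦ (hder e he).differentiableAt.differentiableWithinAt)
    (fun e he ↦ (hder e he).fderiv) hyr (Metric.mem_ball_self hr)
  simpa only [Function.comp_apply, (extChartAt I x).left_inv hy, extChartAt_to_inv] using hconst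

theorem eq_of_mvfderiv_eq_zero [PreconnectedSpace M] (hf : MDiff f) (hcrit : ∀ x, d% f x = 0)
    (x y : M) : f x = f y :=
  (isLocallyConstant_of_mvfderiv_eq_zero hf hcrit).apply_eq_of_preconnectedSpace x y

end Constant

/-! ### The contravariant metric -/

section Cometric

theorem isInvertible_of_nondegenerate {V : Type*} [NormedAddCommGroup V] [NormedSpace ℝ V]
    [FiniteDimensional ℝ V] (β : V →L[ℝ] V →L[ℝ] ℝ) (hβ : ∀ v, (∀ w, β v w = 0) → v = 0) :
    β.IsInvertible := by
  have hinj : Function.Injective (β : V →ₗ[ℝ] V →L[ℝ] ℝ) :=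
    (injective_iff_map_eq_zero _).2 fun v hv ↦ hβ v fun w ↦ DFunLike.congr_fun hv w
  have hdim : Module.finrank ℝ V = Module.finrank ℝ (V →L[ℝ] ℝ) := by
    rw [← Subspace.dual_finrank_eq]
    exact (LinearMap.toContinuousLinearMap : (V →ₗ[ℝ] ℝ) ≃ₗ[ℝ] (V →L[ℝ] ℝ)).finrank_eq
  exact ⟨(LinearEquiv.ofInjectiveOfFinrankEq (β : V →ₗ[ℝ] V →L[ℝ] ℝ) hinj
    hdim).toContinuousLinearEquiv, rfl⟩

section Conjugation

open ContinuousLinearMap (precomp)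

variable {V W : Type*} [AddCommGroup V] [Module ℝ V] [TopologicalSpace V]
  [AddCommGroup W] [Module ℝ W] [TopologicalSpace W]

theorem isInvertible_precomp {A : V →L[ℝ] W} (hA : A.IsInvertible) :
    (precomp ℝ A : (W →L[ℝ] ℝ) →L[ℝ] V →L[ℝ] ℝ).IsInvertible := by
  obtain ⟨A, rfl⟩ := hA
  exact .of_inverse (g := precomp ℝ (A.symm : W →L[ℝ] V)) (by ext; simp) (by ext; simp)

theorem comp_inverse_comp_precomp {A : V →L[ℝ] W} (hA : A.IsInvertible)
    (β : W →L[ℝ] W →L[ℝ] ℝ) :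
    A ∘L (precomp ℝ A ∘L β ∘L A).inverse ∘L precomp ℝ A = β.inverse := by
  have hA' := isInvertible_precomp hA
  ext p
  rw [hA'.inverse_comp_of_left, hA.inverse_comp_of_right]
  obtain ⟨A, rfl⟩ := hA
  simpa using congrArg β.inverse (hA'.inverse_apply_self p)

end Conjugation

variable {E : Type*} [NormedAddCommGroup E] [NormedSpace ℝ E]
  {H : Type*} [TopologicalSpace H] {I : ModelWithCorners ℝ E H}
  {M : Type*} [TopologicalSpace M] [ChartedSpace H M] [IsManifold I ∞ M]

theorem contMDiffAt_trivializationAt_symmL (x : M) (v : E) :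
    ContMDiffAt I (I.prod 𝓘(ℝ, E)) ∞ (fun y ↦ (Bundle.TotalSpace.mk' E y
      ((trivializationAt E (TangentSpace I) x).symmL ℝ y v) : TangentBundle I M)) x := by
  rw [Bundle.contMDiffAt_section]
  refine (contMDiffAt_const (c := v)).congr_of_eventuallyEq ?_
  filter_upwards [(trivializationAt E (TangentSpace I) x).open_baseSet.mem_nhds
    (FiberBundle.mem_baseSet_trivializationAt' x)] with y hy
  rw [Bundle.Trivialization.symmL_apply _ hy]
  exact congrArg Prod.snd (Bundle.Trivialization.apply_mk_symm _ hy v)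

/-- The covariant tensor field `g` read in the extended chart at `x₀`. It is written with the
tangent bundle trivialization at `x₀`, which is the differential of that chart. -/
def covTensorInChart (g : CovTensor I M) (x₀ y : M) : E →L[ℝ] E →L[ℝ] ℝ :=
  ContinuousLinearMap.precomp ℝ ((trivializationAt E (TangentSpace I) x₀).symmL ℝ y) ∘L g y ∘L
    (trivializationAt E (TangentSpace I) x₀).symmL ℝ y

theorem precomp_chartDiff_comp_covTensorInChart (g : CovTensor I M) {x₀ y : M}
    (hy : y ∈ (chartAt H x₀).source) :
    ContinuousLinearMap.precomp ℝ (chartDiff I x₀ y) ∘L covTensorInChart g x₀ y ∘L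
      chartDiff I x₀ y = g y := by
  have hsymm (v : TangentSpace I y) :
      (trivializationAt E (TangentSpace I) x₀).symmL ℝ y (chartDiff I x₀ y v) = v := by
    rw [show chartDiff I x₀ y =
        (trivializationAt E (TangentSpace I) x₀).continuousLinearMapAt ℝ y from
      (TangentBundle.continuousLinearMapAt_trivializationAt hy).symm]
    exact Bundle.Trivialization.symmL_continuousLinearMapAt _ hy v
  ext v w
  simp [covTensorInChart, hsymm]

theorem tensorInChart_cometric (g : CovTensor I M) {x₀ y : M} (hy : y ∈ (chartAt H x₀).source) :
    tensorInChart I (cometric I g) x₀ y = (covTensorInChart g x₀ y).inverse := by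
  rw [← comp_inverse_comp_precomp (isInvertible_chartDiff (I := I) (by simpa using hy)),
    precomp_chartDiff_comp_covTensorInChart g hy]
  rfl

variable [FiniteDimensional ℝ E] {g : CovTensor I M}

namespace IsPseudoRiemannianMetric

theorem isInvertible (hg : IsPseudoRiemannianMetric I g) (x : M) : (g x).IsInvertible :=
  isInvertible_of_nondegenerate (V := E) (g x) (hg.nondegenerate x)

theorem apply_cometric (hg : IsPseudoRiemannianMetric I g) (x : M)
    (p : TangentSpace I x →L[ℝ] ℝ) : g x (cometric I g x p) = p :=
  (hg.isInvertible x).self_apply_inverse p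

theorem cometric_apply (hg : IsPseudoRiemannianMetric I g) (x : M) (v : TangentSpace I x) :
    cometric I g x (g x v) = v :=
  (hg.isInvertible x).inverse_apply_self v

theorem cometric_symm (hg : IsPseudoRiemannianMetric I g) (x : M)
    (p q : TangentSpace I x →L[ℝ] ℝ) : p (cometric I g x q) = q (cometric I g x p) :=
  calc p (cometric I g x q) = g x (cometric I g x p) (cometric I g x q) := by
        rw [hg.apply_cometric]
    _ = g x (cometric I g x q) (cometric I g x p) := hg.symm x _ _
    _ = q (cometric I g x p) := by rw [hg.apply_cometric]

theorem contMDiffAt_covTensorInChart (hg : IsPseudoRiemannianMetric I g) (x : M) :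
    CMDiffAt ∞ (covTensorInChart g x) x := by
  refine contMDiffAt_clm_of_forall_apply fun v ↦ contMDiffAt_clm_of_forall_apply fun w ↦ ?_
  have hsection := ContMDiffAt.clm_bundle_apply₂ (F₁ := E) (F₂ := E) (F₃ := ℝ)
    (E₃ := Bundle.Trivial M ℝ) (hg.smooth x) (contMDiffAt_trivializationAt_symmL x v)
    (contMDiffAt_trivializationAt_symmL x w)
  exact (Bundle.contMDiffAt_totalSpace.1 hsection).2

theorem isInvertible_covTensorInChart (hg : IsPseudoRiemannianMetric I g) (x : M) :
    (covTensorInChart g x x).IsInvertible := by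
  refine isInvertible_of_nondegenerate _ fun v hv ↦ ?_
  obtain ⟨A, hA⟩ := isInvertible_chartDiff (mem_extChartAt_source (I := I) x)
  have hconj := precomp_chartDiff_comp_covTensorInChart g (mem_chart_source H x)
  rw [← hA] at hconj
  have hzero := hg.nondegenerate x (A.symm v) fun w ↦ by simp [← hconj, hv]
  simpa using hzero

theorem isSymmetricTensorField_cometric [I.Boundaryless] (hg : IsPseudoRiemannianMetric I g) :
    IsSymmetricTensorField I (cometric I g) where
  symm := hg.cometric_symm
  smooth x _ _ hf hh := by
    refine contMDiffAt_contraction_of_tensorInChart ?_ hf hh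
    refine ((hg.isInvertible_covTensorInChart x).contDiffAt_map_inverse.contMDiffAt.comp x
      (hg.contMDiffAt_covTensorInChart x)).congr_of_eventuallyEq ?_
    filter_upwards [chart_source_mem_nhds H x] with y hy
    exact tensorInChart_cometric g hy

end IsPseudoRiemannianMetric

end Cometric

/-! ### Block-diagonal tensor fields on a product -/

section Product

variable {EB : Type*} [NormedAddCommGroup EB] [NormedSpace ℝ EB]
  {HB : Type*} [TopologicalSpace HB] {IB : ModelWithCorners ℝ EB HB}
  {B : Type*} [TopologicalSpace B] [ChartedSpace HB B]
  {EF : Type*} [NormedAddCommGroup EF] [NormedSpace ℝ EF]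
  {HF : Type*} [TopologicalSpace HF] {IF : ModelWithCorners ℝ EF HF}
  {F : Type*} [TopologicalSpace F] [ChartedSpace HF F]

/-- The component of `T` along `B`, restricted to the slice `B × {y}`. -/
def baseBlock (T : ContraTensor (IB.prod IF) (B × F)) (y : F) : ContraTensor IB B :=
  fun b ↦ pushforward (IB.prod IF) IB Prod.fst (b, y) (T (b, y))

/-- The component of `T` along `F`, restricted to the slice `{b} × F`. -/
def fiberBlock (T : ContraTensor (IB.prod IF) (B × F)) (b : B) : ContraTensor IF F :=
  fun y ↦ pushforward (IB.prod IF) IF Prod.snd (b, y) (T (b, y))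

/-- The mixed components of `T` vanish: `T` maps covectors lifted from one factor to vectors
tangent to that factor. -/
structure IsBlockDiagonal (T : ContraTensor (IB.prod IF) (B × F)) : Prop where
  mfderiv_snd_eq_zero : ∀ (z : B × F) (p : TangentSpace IB z.1 →L[ℝ] ℝ),
    mfderiv (IB.prod IF) IF Prod.snd z (T z (p ∘L mfderiv (IB.prod IF) IB Prod.fst z)) = 0
  mfderiv_fst_eq_zero : ∀ (z : B × F) (q : TangentSpace IF z.2 →L[ℝ] ℝ),
    mfderiv (IB.prod IF) IB Prod.fst z (T z (q ∘L mfderiv (IB.prod IF) IF Prod.snd z)) = 0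

variable {K G T : ContraTensor (IB.prod IF) (B × F)} {z : B × F}

theorem mvfderiv_comp_fst {f : B → ℝ} (hf : MDiffAt f z.1) :
    mvfderiv (IB.prod IF) (f ∘ Prod.fst) z = d% f z.1 ∘L mfderiv (IB.prod IF) IB Prod.fst z :=
  mvfderiv_comp z hf mdifferentiableAt_fst

theorem mvfderiv_comp_snd {f : F → ℝ} (hf : MDiffAt f z.2) :
    mvfderiv (IB.prod IF) (f ∘ Prod.snd) z = d% f z.2 ∘L mfderiv (IB.prod IF) IF Prod.snd z :=
  mvfderiv_comp z hf mdifferentiableAt_snd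

theorem mvfderiv_prod_apply {f : B × F → ℝ} (hf : MDiffAt f z) (v : TangentSpace (IB.prod IF) z) :
    d% f z v = d% (fun b ↦ f (b, z.2)) z.1 (mfderiv (IB.prod IF) IB Prod.fst z v)
      + d% (fun y ↦ f (z.1, y)) z.2 (mfderiv (IB.prod IF) IF Prod.snd z v) := by
  rw [mfderiv_fst, mfderiv_snd]
  exact mfderiv_prod_eq_add_apply hf

theorem contraction_fst_fst (T : ContraTensor (IB.prod IF) (B × F)) {f h : B → ℝ}
    (hf : MDiffAt f z.1) (hh : MDiffAt h z.1) :
    contraction (IB.prod IF) T (f ∘ Prod.fst) (h ∘ Prod.fst) z =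
      contraction IB (baseBlock T z.2) f h z.1 := by
  rw [contraction, mvfderiv_comp_fst hf, mvfderiv_comp_fst hh]
  rfl

theorem contraction_snd_snd (T : ContraTensor (IB.prod IF) (B × F)) {f h : F → ℝ}
    (hf : MDiffAt f z.2) (hh : MDiffAt h z.2) :
    contraction (IB.prod IF) T (f ∘ Prod.snd) (h ∘ Prod.snd) z =
      contraction IF (fiberBlock T z.1) f h z.2 := by
  rw [contraction, mvfderiv_comp_snd hf, mvfderiv_comp_snd hh]
  rfl

namespace IsBlockDiagonal

theorem contraction_fst_snd (hT : IsBlockDiagonal T) {f : B → ℝ} {h : F → ℝ}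
    (hf : MDiffAt f z.1) (hh : MDiffAt h z.2) :
    contraction (IB.prod IF) T (f ∘ Prod.fst) (h ∘ Prod.snd) z = 0 := by
  rw [contraction, mvfderiv_comp_fst hf, mvfderiv_comp_snd hh,
    ContinuousLinearMap.comp_apply, hT.mfderiv_fst_eq_zero, map_zero]

theorem contraction_snd_fst (hT : IsBlockDiagonal T) {f : B → ℝ} {h : F → ℝ}
    (hf : MDiffAt f z.1) (hh : MDiffAt h z.2) :
    contraction (IB.prod IF) T (h ∘ Prod.snd) (f ∘ Prod.fst) z = 0 := by
  rw [contraction, mvfderiv_comp_fst hf, mvfderiv_comp_snd hh,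
    ContinuousLinearMap.comp_apply, hT.mfderiv_snd_eq_zero, map_zero]

theorem mvfderiv_apply_fst (hT : IsBlockDiagonal T) {f : B × F → ℝ} {u : B → ℝ}
    (hf : MDiffAt f z) (hu : MDiffAt u z.1) :
    d% f z (T z (mvfderiv (IB.prod IF) (u ∘ Prod.fst) z)) =
      d% (fun b ↦ f (b, z.2)) z.1 (baseBlock T z.2 z.1 (d% u z.1)) := by
  rw [mvfderiv_comp_fst hu, mvfderiv_prod_apply hf, hT.mfderiv_snd_eq_zero, map_zero, add_zero]
  rfl

theorem mvfderiv_apply_snd (hT : IsBlockDiagonal T) {f : B × F → ℝ} {u : F → ℝ}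
    (hf : MDiffAt f z) (hu : MDiffAt u z.2) :
    d% f z (T z (mvfderiv (IB.prod IF) (u ∘ Prod.snd) z)) =
      d% (fun y ↦ f (z.1, y)) z.2 (fiberBlock T z.1 z.2 (d% u z.2)) := by
  rw [mvfderiv_comp_snd hu, mvfderiv_prod_apply hf, hT.mfderiv_fst_eq_zero, map_zero, zero_add]
  rfl

end IsBlockDiagonal

theorem contMDiffAt_comp_fst {f : B → ℝ} (hf : CMDiffAt ∞ f z.1) :
    ContMDiffAt (IB.prod IF) 𝓘(ℝ, ℝ) ∞ (f ∘ Prod.fst) z :=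
  hf.comp z contMDiffAt_fst

theorem contMDiffAt_comp_snd {f : F → ℝ} (hf : CMDiffAt ∞ f z.2) :
    ContMDiffAt (IB.prod IF) 𝓘(ℝ, ℝ) ∞ (f ∘ Prod.snd) z :=
  hf.comp z contMDiffAt_snd

theorem contraction_fst_fst_slice_eventuallyEq [IsManifold IB ∞ B]
    (T : ContraTensor (IB.prod IF) (B × F)) {b : B} (y : F) {f h : B → ℝ}
    (hf : CMDiffAt ∞ f b) (hh : CMDiffAt ∞ h b) :
    (fun b' ↦ contraction (IB.prod IF) T (f ∘ Prod.fst) (h ∘ Prod.fst) (b', y)) =ᶠ[𝓝 b]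
      contraction IB (baseBlock T y) f h := by
  filter_upwards [eventually_mdifferentiableAt hf, eventually_mdifferentiableAt hh] with b' hfb hhb
  exact contraction_fst_fst T (z := (b', y)) hfb hhb

theorem contraction_snd_snd_slice_eventuallyEq [IsManifold IF ∞ F]
    (T : ContraTensor (IB.prod IF) (B × F)) (b : B) {y : F} {f h : F → ℝ}
    (hf : CMDiffAt ∞ f y) (hh : CMDiffAt ∞ h y) :
    (fun y' ↦ contraction (IB.prod IF) T (f ∘ Prod.snd) (h ∘ Prod.snd) (b, y')) =ᶠ[𝓝 y]
      contraction IF (fiberBlock T b) f h := by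
  filter_upwards [eventually_mdifferentiableAt hf, eventually_mdifferentiableAt hh] with y' hfy hhy
  exact contraction_snd_snd T (z := (b, y')) hfy hhy

namespace IsBlockDiagonal

theorem mvfderiv_contraction_fst_fst_apply_fst [IsManifold IB ∞ B] (hK : IsBlockDiagonal K)
    (hG : IsSymmetricTensorField (IB.prod IF) G) {u f h : B → ℝ} (hu : CMDiffAt ∞ u z.1)
    (hf : CMDiffAt ∞ f z.1) (hh : CMDiffAt ∞ h z.1) :
    d% (contraction (IB.prod IF) G (f ∘ Prod.fst) (h ∘ Prod.fst)) z
        (K z (mvfderiv (IB.prod IF) (u ∘ Prod.fst) z)) =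
      d% (contraction IB (baseBlock G z.2) f h) z.1 (baseBlock K z.2 z.1 (d% u z.1)) := by
  rw [hK.mvfderiv_apply_fst
      (hG.mdifferentiableAt (contMDiffAt_comp_fst hf) (contMDiffAt_comp_fst hh))
      (hu.mdifferentiableAt (by simp)),
    mvfderiv_congr_of_eventuallyEq (contraction_fst_fst_slice_eventuallyEq G z.2 hf hh)]

theorem mvfderiv_contraction_snd_snd_apply_snd [IsManifold IF ∞ F] (hK : IsBlockDiagonal K)
    (hG : IsSymmetricTensorField (IB.prod IF) G) {u f h : F → ℝ} (hu : CMDiffAt ∞ u z.2)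
    (hf : CMDiffAt ∞ f z.2) (hh : CMDiffAt ∞ h z.2) :
    d% (contraction (IB.prod IF) G (f ∘ Prod.snd) (h ∘ Prod.snd)) z
        (K z (mvfderiv (IB.prod IF) (u ∘ Prod.snd) z)) =
      d% (contraction IF (fiberBlock G z.1) f h) z.2 (fiberBlock K z.1 z.2 (d% u z.2)) := by
  rw [hK.mvfderiv_apply_snd
      (hG.mdifferentiableAt (contMDiffAt_comp_snd hf) (contMDiffAt_comp_snd hh))
      (hu.mdifferentiableAt (by simp)),
    mvfderiv_congr_of_eventuallyEq (contraction_snd_snd_slice_eventuallyEq G z.1 hf hh)]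

theorem mvfderiv_contraction_fst_fst_apply_snd (hK : IsBlockDiagonal K)
    (hG : IsSymmetricTensorField (IB.prod IF) G) {u : F → ℝ} {f h : B → ℝ}
    (hu : CMDiffAt ∞ u z.2) (hf : CMDiffAt ∞ f z.1) (hh : CMDiffAt ∞ h z.1) :
    d% (contraction (IB.prod IF) G (f ∘ Prod.fst) (h ∘ Prod.fst)) z
        (K z (mvfderiv (IB.prod IF) (u ∘ Prod.snd) z)) =
      d% (fun y ↦ contraction IB (baseBlock G y) f h z.1) z.2
        (fiberBlock K z.1 z.2 (d% u z.2)) := by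
  have hslice : (fun y ↦ contraction (IB.prod IF) G (f ∘ Prod.fst) (h ∘ Prod.fst) (z.1, y)) =
      fun y ↦ contraction IB (baseBlock G y) f h z.1 :=
    funext fun y ↦ contraction_fst_fst G (z := (z.1, y)) (hf.mdifferentiableAt (by simp))
      (hh.mdifferentiableAt (by simp))
  rw [hK.mvfderiv_apply_snd
    (hG.mdifferentiableAt (contMDiffAt_comp_fst hf) (contMDiffAt_comp_fst hh))
    (hu.mdifferentiableAt (by simp)), hslice]

theorem mvfderiv_contraction_snd_snd_apply_fst (hK : IsBlockDiagonal K)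
    (hG : IsSymmetricTensorField (IB.prod IF) G) {u : B → ℝ} {f h : F → ℝ}
    (hu : CMDiffAt ∞ u z.1) (hf : CMDiffAt ∞ f z.2) (hh : CMDiffAt ∞ h z.2) :
    d% (contraction (IB.prod IF) G (f ∘ Prod.snd) (h ∘ Prod.snd)) z
        (K z (mvfderiv (IB.prod IF) (u ∘ Prod.fst) z)) =
      d% (fun b ↦ contraction IF (fiberBlock G b) f h z.2) z.1
        (baseBlock K z.2 z.1 (d% u z.1)) := by
  have hslice : (fun b ↦ contraction (IB.prod IF) G (f ∘ Prod.snd) (h ∘ Prod.snd) (b, z.2)) =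
      fun b ↦ contraction IF (fiberBlock G b) f h z.2 :=
    funext fun b ↦ contraction_snd_snd G (z := (b, z.2)) (hf.mdifferentiableAt (by simp))
      (hh.mdifferentiableAt (by simp))
  rw [hK.mvfderiv_apply_fst
    (hG.mdifferentiableAt (contMDiffAt_comp_snd hf) (contMDiffAt_comp_snd hh))
    (hu.mdifferentiableAt (by simp)), hslice]

variable [IsManifold IB ∞ B] [IsManifold IF ∞ F]

theorem contraction_fst_snd_eventuallyEq (hT : IsBlockDiagonal T) {f : B → ℝ} {h : F → ℝ}
    (hf : CMDiffAt ∞ f z.1) (hh : CMDiffAt ∞ h z.2) :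
    contraction (IB.prod IF) T (f ∘ Prod.fst) (h ∘ Prod.snd) =ᶠ[𝓝 z] fun _ ↦ 0 := by
  filter_upwards [continuousAt_fst.eventually (eventually_mdifferentiableAt hf),
    continuousAt_snd.eventually (eventually_mdifferentiableAt hh)] with z' hfz hhz
  exact hT.contraction_fst_snd hfz hhz

theorem contraction_snd_fst_eventuallyEq (hT : IsBlockDiagonal T) {f : B → ℝ} {h : F → ℝ}
    (hf : CMDiffAt ∞ f z.1) (hh : CMDiffAt ∞ h z.2) :
    contraction (IB.prod IF) T (h ∘ Prod.snd) (f ∘ Prod.fst) =ᶠ[𝓝 z] fun _ ↦ 0 := by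
  filter_upwards [continuousAt_fst.eventually (eventually_mdifferentiableAt hf),
    continuousAt_snd.eventually (eventually_mdifferentiableAt hh)] with z' hfz hhz
  exact hT.contraction_snd_fst hfz hhz

theorem mvfderiv_contraction_fst_snd (hT : IsBlockDiagonal T) {f : B → ℝ} {h : F → ℝ}
    (hf : CMDiffAt ∞ f z.1) (hh : CMDiffAt ∞ h z.2) :
    d% (contraction (IB.prod IF) T (f ∘ Prod.fst) (h ∘ Prod.snd)) z = 0 := by
  rw [mvfderiv_congr_of_eventuallyEq (hT.contraction_fst_snd_eventuallyEq hf hh), mvfderiv_const]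

theorem mvfderiv_contraction_snd_fst (hT : IsBlockDiagonal T) {f : B → ℝ} {h : F → ℝ}
    (hf : CMDiffAt ∞ f z.1) (hh : CMDiffAt ∞ h z.2) :
    d% (contraction (IB.prod IF) T (h ∘ Prod.snd) (f ∘ Prod.fst)) z = 0 := by
  rw [mvfderiv_congr_of_eventuallyEq (hT.contraction_snd_fst_eventuallyEq hf hh), mvfderiv_const]

end IsBlockDiagonal

theorem schouten_fst_fst_fst [IsManifold IB ∞ B] (hK : IsSymmetricTensorField (IB.prod IF) K)
    (hG : IsSymmetricTensorField (IB.prod IF) G) (hKb : IsBlockDiagonal K)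
    (hGb : IsBlockDiagonal G) {f₁ f₂ f₃ : B → ℝ} (hf₁ : CMDiffAt ∞ f₁ z.1)
    (hf₂ : CMDiffAt ∞ f₂ z.1) (hf₃ : CMDiffAt ∞ f₃ z.1) :
    schouten (IB.prod IF) K G (f₁ ∘ Prod.fst) (f₂ ∘ Prod.fst) (f₃ ∘ Prod.fst) z =
      schouten IB (baseBlock K z.2) (baseBlock G z.2) f₁ f₂ f₃ z.1 := by
  simp only [schouten_eq_sum_schoutenTerm, schoutenTerm]
  simp_rw [hKb.mvfderiv_contraction_fst_fst_apply_fst hG hf₁ hf₂ hf₃,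
    hKb.mvfderiv_contraction_fst_fst_apply_fst hG hf₂ hf₃ hf₁,
    hKb.mvfderiv_contraction_fst_fst_apply_fst hG hf₃ hf₁ hf₂,
    hGb.mvfderiv_contraction_fst_fst_apply_fst hK hf₁ hf₂ hf₃,
    hGb.mvfderiv_contraction_fst_fst_apply_fst hK hf₂ hf₃ hf₁,
    hGb.mvfderiv_contraction_fst_fst_apply_fst hK hf₃ hf₁ hf₂]

theorem schouten_snd_snd_snd [IsManifold IF ∞ F] (hK : IsSymmetricTensorField (IB.prod IF) K)
    (hG : IsSymmetricTensorField (IB.prod IF) G) (hKb : IsBlockDiagonal K)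
    (hGb : IsBlockDiagonal G) {f₁ f₂ f₃ : F → ℝ} (hf₁ : CMDiffAt ∞ f₁ z.2)
    (hf₂ : CMDiffAt ∞ f₂ z.2) (hf₃ : CMDiffAt ∞ f₃ z.2) :
    schouten (IB.prod IF) K G (f₁ ∘ Prod.snd) (f₂ ∘ Prod.snd) (f₃ ∘ Prod.snd) z =
      schouten IF (fiberBlock K z.1) (fiberBlock G z.1) f₁ f₂ f₃ z.2 := by
  simp only [schouten_eq_sum_schoutenTerm, schoutenTerm]
  simp_rw [hKb.mvfderiv_contraction_snd_snd_apply_snd hG hf₁ hf₂ hf₃,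
    hKb.mvfderiv_contraction_snd_snd_apply_snd hG hf₂ hf₃ hf₁,
    hKb.mvfderiv_contraction_snd_snd_apply_snd hG hf₃ hf₁ hf₂,
    hGb.mvfderiv_contraction_snd_snd_apply_snd hK hf₁ hf₂ hf₃,
    hGb.mvfderiv_contraction_snd_snd_apply_snd hK hf₂ hf₃ hf₁,
    hGb.mvfderiv_contraction_snd_snd_apply_snd hK hf₃ hf₁ hf₂]

variable [IsManifold IB ∞ B] [IsManifold IF ∞ F]

theorem schouten_snd_fst_fst (hK : IsSymmetricTensorField (IB.prod IF) K)
    (hG : IsSymmetricTensorField (IB.prod IF) G) (hKb : IsBlockDiagonal K)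
    (hGb : IsBlockDiagonal G) {u : F → ℝ} {f h : B → ℝ} (hu : CMDiffAt ∞ u z.2)
    (hf : CMDiffAt ∞ f z.1) (hh : CMDiffAt ∞ h z.1) :
    schouten (IB.prod IF) K G (u ∘ Prod.snd) (f ∘ Prod.fst) (h ∘ Prod.fst) z = (2 / 3 : ℝ) *
      (d% (fun y ↦ contraction IB (baseBlock G y) f h z.1) z.2 (fiberBlock K z.1 z.2 (d% u z.2))
        - d% (fun y ↦ contraction IB (baseBlock K y) f h z.1) z.2
          (fiberBlock G z.1 z.2 (d% u z.2))) := by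
  simp only [schouten_eq_sum_schoutenTerm, schoutenTerm]
  rw [hKb.mvfderiv_contraction_fst_snd hh hu, hGb.mvfderiv_contraction_fst_snd hh hu,
    hKb.mvfderiv_contraction_snd_fst hf hu, hGb.mvfderiv_contraction_snd_fst hf hu,
    hKb.mvfderiv_contraction_fst_fst_apply_snd hG hu hf hh,
    hGb.mvfderiv_contraction_fst_fst_apply_snd hK hu hf hh]
  simp

theorem schouten_fst_snd_snd (hK : IsSymmetricTensorField (IB.prod IF) K)
    (hG : IsSymmetricTensorField (IB.prod IF) G) (hKb : IsBlockDiagonal K)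
    (hGb : IsBlockDiagonal G) {u : B → ℝ} {f h : F → ℝ} (hu : CMDiffAt ∞ u z.1)
    (hf : CMDiffAt ∞ f z.2) (hh : CMDiffAt ∞ h z.2) :
    schouten (IB.prod IF) K G (u ∘ Prod.fst) (f ∘ Prod.snd) (h ∘ Prod.snd) z = (2 / 3 : ℝ) *
      (d% (fun b ↦ contraction IF (fiberBlock G b) f h z.2) z.1 (baseBlock K z.2 z.1 (d% u z.1))
        - d% (fun b ↦ contraction IF (fiberBlock K b) f h z.2) z.1
          (baseBlock G z.2 z.1 (d% u z.1))) := by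
  simp only [schouten_eq_sum_schoutenTerm, schoutenTerm]
  rw [hKb.mvfderiv_contraction_fst_snd hu hf, hGb.mvfderiv_contraction_fst_snd hu hf,
    hKb.mvfderiv_contraction_snd_fst hu hh, hGb.mvfderiv_contraction_snd_fst hu hh,
    hKb.mvfderiv_contraction_snd_snd_apply_fst hG hu hf hh,
    hGb.mvfderiv_contraction_snd_snd_apply_fst hK hu hf hh]
  simp

end Product

/-! ### Testing on functions of one factor -/

section Factors

variable {EB : Type*} [NormedAddCommGroup EB] [NormedSpace ℝ EB] [FiniteDimensional ℝ EB]
  {HB : Type*} [TopologicalSpace HB] {IB : ModelWithCorners ℝ EB HB} [IB.Boundaryless]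
  {B : Type*} [TopologicalSpace B] [ChartedSpace HB B] [IsManifold IB ∞ B]
  {EF : Type*} [NormedAddCommGroup EF] [NormedSpace ℝ EF] [FiniteDimensional ℝ EF]
  {HF : Type*} [TopologicalSpace HF] {IF : ModelWithCorners ℝ EF HF} [IF.Boundaryless]
  {F : Type*} [TopologicalSpace F] [ChartedSpace HF F] [IsManifold IF ∞ F]
  {K G : ContraTensor (IB.prod IF) (B × F)} {z : B × F} {f₁ f₂ f₃ : B × F → ℝ}

theorem schouten_eq_zero_of_factors_left (hK : IsSymmetricTensorField (IB.prod IF) K)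
    (hG : IsSymmetricTensorField (IB.prod IF) G) (hf₁ : CMDiffAt ∞ f₁ z) (hf₂ : CMDiffAt ∞ f₂ z)
    (hf₃ : CMDiffAt ∞ f₃ z)
    (hB : ∀ u : B → ℝ, CMDiffAt ∞ u z.1 → schouten _ K G (u ∘ Prod.fst) f₂ f₃ z = 0)
    (hF : ∀ u : F → ℝ, CMDiffAt ∞ u z.2 → schouten _ K G (u ∘ Prod.snd) f₂ f₃ z = 0) :
    schouten _ K G f₁ f₂ f₃ z = 0 := by
  set uB : B → ℝ := fun b ↦ f₁ (b, z.2)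
  set uF : F → ℝ := fun y ↦ f₁ (z.1, y)
  have huB : CMDiffAt ∞ uB z.1 := hf₁.comp z.1 (contMDiffAt_id.prodMk contMDiffAt_const)
  have huF : CMDiffAt ∞ uF z.2 := hf₁.comp z.2 (contMDiffAt_const.prodMk contMDiffAt_id)
  have hfst := contMDiffAt_comp_fst (IF := IF) huB
  have hsnd := contMDiffAt_comp_snd (IB := IB) huF
  have hsplit : d% f₁ z = mvfderiv (IB.prod IF) (uB ∘ Prod.fst + uF ∘ Prod.snd) z := by
    ext v
    rw [mvfderiv_add (hfst.mdifferentiableAt (by simp)) (hsnd.mdifferentiableAt (by simp)),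
      mvfderiv_comp_fst (huB.mdifferentiableAt (by simp)),
      mvfderiv_comp_snd (huF.mdifferentiableAt (by simp)),
      mvfderiv_prod_apply (hf₁.mdifferentiableAt (by simp))]
    rfl
  rw [schouten_congr_left hK hG hf₁ (hfst.add hsnd) hf₂ hf₃ hsplit,
    schouten_add_left hK hG hfst hsnd hf₂ hf₃, hB uB huB, hF uF huF, add_zero]

theorem schouten_eq_zero_of_factors (hK : IsSymmetricTensorField (IB.prod IF) K)
    (hG : IsSymmetricTensorField (IB.prod IF) G)
    (hBBB : ∀ f₁ f₂ f₃ : B → ℝ, CMDiffAt ∞ f₁ z.1 → CMDiffAt ∞ f₂ z.1 → CMDiffAt ∞ f₃ z.1 →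
      schouten _ K G (f₁ ∘ Prod.fst) (f₂ ∘ Prod.fst) (f₃ ∘ Prod.fst) z = 0)
    (hFBB : ∀ (u : F → ℝ) (f h : B → ℝ), CMDiffAt ∞ u z.2 → CMDiffAt ∞ f z.1 →
      CMDiffAt ∞ h z.1 → schouten _ K G (u ∘ Prod.snd) (f ∘ Prod.fst) (h ∘ Prod.fst) z = 0)
    (hBFF : ∀ (u : B → ℝ) (f h : F → ℝ), CMDiffAt ∞ u z.1 → CMDiffAt ∞ f z.2 →
      CMDiffAt ∞ h z.2 → schouten _ K G (u ∘ Prod.fst) (f ∘ Prod.snd) (h ∘ Prod.snd) z = 0)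
    (hFFF : ∀ f₁ f₂ f₃ : F → ℝ, CMDiffAt ∞ f₁ z.2 → CMDiffAt ∞ f₂ z.2 → CMDiffAt ∞ f₃ z.2 →
      schouten _ K G (f₁ ∘ Prod.snd) (f₂ ∘ Prod.snd) (f₃ ∘ Prod.snd) z = 0)
    (hf₁ : CMDiffAt ∞ f₁ z) (hf₂ : CMDiffAt ∞ f₂ z) (hf₃ : CMDiffAt ∞ f₃ z) :
    schouten _ K G f₁ f₂ f₃ z = 0 := by
  refine schouten_eq_zero_of_factors_left hK hG hf₁ hf₂ hf₃ (fun u₁ hu₁ ↦ ?_) (fun u₁ hu₁ ↦ ?_)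
  all_goals
    rw [schouten_cycle]
    refine schouten_eq_zero_of_factors_left hK hG hf₂ hf₃
      (by first | exact contMDiffAt_comp_fst hu₁ | exact contMDiffAt_comp_snd hu₁)
      (fun u₂ hu₂ ↦ ?_) (fun u₂ hu₂ ↦ ?_)
    all_goals
      rw [schouten_cycle]
      refine schouten_eq_zero_of_factors_left hK hG hf₃
        (by first | exact contMDiffAt_comp_fst hu₁ | exact contMDiffAt_comp_snd hu₁)
        (by first | exact contMDiffAt_comp_fst hu₂ | exact contMDiffAt_comp_snd hu₂)
        (fun u₃ hu₃ ↦ ?_) (fun u₃ hu₃ ↦ ?_)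
  · exact hBBB u₃ u₁ u₂ hu₃ hu₁ hu₂
  · exact hFBB u₃ u₁ u₂ hu₃ hu₁ hu₂
  · rw [← schouten_cycle]; exact hFBB u₂ u₃ u₁ hu₂ hu₃ hu₁
  · rw [schouten_cycle]; exact hBFF u₁ u₂ u₃ hu₁ hu₂ hu₃
  · rw [schouten_cycle]; exact hFBB u₁ u₂ u₃ hu₁ hu₂ hu₃
  · rw [← schouten_cycle]; exact hBFF u₂ u₃ u₁ hu₂ hu₃ hu₁
  · exact hBFF u₃ u₁ u₂ hu₃ hu₁ hu₂
  · exact hFFF u₃ u₁ u₂ hu₃ hu₁ hu₂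

end Factors

/-! ### Assembling a tensor field on a product from its blocks -/

section Lifts

variable {EB : Type*} [NormedAddCommGroup EB] [NormedSpace ℝ EB]
  {HB : Type*} [TopologicalSpace HB] {IB : ModelWithCorners ℝ EB HB}
  {B : Type*} [TopologicalSpace B] [ChartedSpace HB B]
  {EF : Type*} [NormedAddCommGroup EF] [NormedSpace ℝ EF]
  {HF : Type*} [TopologicalSpace HF] {IF : ModelWithCorners ℝ EF HF}
  {F : Type*} [TopologicalSpace F] [ChartedSpace HF F]

variable (IB IF) in
/-- The differential at `z` of the inclusion of the slice `B × {z.2}`. -/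
def tangentInl (z : B × F) : TangentSpace IB z.1 →L[ℝ] TangentSpace (IB.prod IF) z :=
  mfderiv IB (IB.prod IF) (fun b ↦ (b, z.2)) z.1

variable (IB IF) in
/-- The differential at `z` of the inclusion of the slice `{z.1} × F`. -/
def tangentInr (z : B × F) : TangentSpace IF z.2 →L[ℝ] TangentSpace (IB.prod IF) z :=
  mfderiv IF (IB.prod IF) (fun y ↦ (z.1, y)) z.2

/-- The tensor field with vanishing mixed components whose component along `B` at `(b, y)` is
`T y b` and whose component along `F` is `S b y`. -/
def blockDiag (T : F → ContraTensor IB B) (S : B → ContraTensor IF F) :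
    ContraTensor (IB.prod IF) (B × F) :=
  fun z ↦ liftBase IB IF (T z.2) z + liftFiber IB IF (S z.1) z

variable {z : B × F}

theorem mfderiv_fst_comp_tangentInl :
    mfderiv (IB.prod IF) IB Prod.fst z ∘L tangentInl IB IF z = .id ℝ (TangentSpace IB z.1) := by
  rw [mfderiv_fst, tangentInl, mfderiv_prod_left]
  rfl

theorem mfderiv_snd_comp_tangentInr :
    mfderiv (IB.prod IF) IF Prod.snd z ∘L tangentInr IB IF z = .id ℝ (TangentSpace IF z.2) := by
  rw [mfderiv_snd, tangentInr, mfderiv_prod_right]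
  rfl

theorem mfderiv_fst_comp_tangentInr :
    mfderiv (IB.prod IF) IB Prod.fst z ∘L tangentInr IB IF z = 0 := by
  rw [mfderiv_fst, tangentInr, mfderiv_prod_right]
  rfl

theorem mfderiv_snd_comp_tangentInl :
    mfderiv (IB.prod IF) IF Prod.snd z ∘L tangentInl IB IF z = 0 := by
  rw [mfderiv_snd, tangentInl, mfderiv_prod_left]
  rfl

theorem mfderiv_fst_tangentInl (v : TangentSpace IB z.1) :
    mfderiv (IB.prod IF) IB Prod.fst z (tangentInl IB IF z v) = v :=
  DFunLike.congr_fun mfderiv_fst_comp_tangentInl v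

theorem mfderiv_snd_tangentInr (w : TangentSpace IF z.2) :
    mfderiv (IB.prod IF) IF Prod.snd z (tangentInr IB IF z w) = w :=
  DFunLike.congr_fun mfderiv_snd_comp_tangentInr w

theorem mfderiv_fst_tangentInr (w : TangentSpace IF z.2) :
    mfderiv (IB.prod IF) IB Prod.fst z (tangentInr IB IF z w) = 0 :=
  DFunLike.congr_fun mfderiv_fst_comp_tangentInr w

theorem mfderiv_snd_tangentInl (v : TangentSpace IB z.1) :
    mfderiv (IB.prod IF) IF Prod.snd z (tangentInl IB IF z v) = 0 :=
  DFunLike.congr_fun mfderiv_snd_comp_tangentInl v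

theorem covector_eq_add (p : TangentSpace (IB.prod IF) z →L[ℝ] ℝ) :
    p = (p ∘L tangentInl IB IF z) ∘L mfderiv (IB.prod IF) IB Prod.fst z
      + (p ∘L tangentInr IB IF z) ∘L mfderiv (IB.prod IF) IF Prod.snd z := by
  rw [mfderiv_fst, mfderiv_snd, tangentInl, tangentInr, mfderiv_prod_left, mfderiv_prod_right]
  ext v
  exact (congrArg p (Prod.fst_add_snd v).symm).trans (map_add p _ _)

theorem tangent_prod_ext {v w : TangentSpace (IB.prod IF) z}
    (hfst : mfderiv (IB.prod IF) IB Prod.fst z v = mfderiv (IB.prod IF) IB Prod.fst z w)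
    (hsnd : mfderiv (IB.prod IF) IF Prod.snd z v = mfderiv (IB.prod IF) IF Prod.snd z w) :
    v = w := by
  rw [mfderiv_fst] at hfst
  rw [mfderiv_snd] at hsnd
  exact Prod.ext hfst hsnd

namespace IsBlockDiagonal

variable {T : ContraTensor (IB.prod IF) (B × F)}

theorem mfderiv_fst_apply (hT : IsBlockDiagonal T) (p : TangentSpace (IB.prod IF) z →L[ℝ] ℝ) :
    mfderiv (IB.prod IF) IB Prod.fst z (T z p) =
      baseBlock T z.2 z.1 (p ∘L tangentInl IB IF z) := by
  conv_lhs => rw [covector_eq_add p, map_add, map_add, hT.mfderiv_fst_eq_zero, add_zero]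
  rfl

theorem mfderiv_snd_apply (hT : IsBlockDiagonal T) (p : TangentSpace (IB.prod IF) z →L[ℝ] ℝ) :
    mfderiv (IB.prod IF) IF Prod.snd z (T z p) =
      fiberBlock T z.1 z.2 (p ∘L tangentInr IB IF z) := by
  conv_lhs => rw [covector_eq_add p, map_add, map_add, hT.mfderiv_snd_eq_zero, zero_add]
  rfl

theorem apply_apply (hT : IsBlockDiagonal T) (p q : TangentSpace (IB.prod IF) z →L[ℝ] ℝ) :
    p (T z q) =
      (p ∘L tangentInl IB IF z) (baseBlock T z.2 z.1 (q ∘L tangentInl IB IF z))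
        + (p ∘L tangentInr IB IF z) (fiberBlock T z.1 z.2 (q ∘L tangentInr IB IF z)) := by
  rw [← hT.mfderiv_fst_apply, ← hT.mfderiv_snd_apply]
  exact DFunLike.congr_fun (covector_eq_add p) (T z q)

end IsBlockDiagonal

variable (T : F → ContraTensor IB B) (S : B → ContraTensor IF F)

theorem mfderiv_fst_blockDiag (p : TangentSpace (IB.prod IF) z →L[ℝ] ℝ) :
    mfderiv (IB.prod IF) IB Prod.fst z (blockDiag T S z p) =
      T z.2 z.1 (p ∘L tangentInl IB IF z) := by
  change mfderiv (IB.prod IF) IB Prod.fst z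
    (tangentInl IB IF z (T z.2 z.1 (p ∘L tangentInl IB IF z))
      + tangentInr IB IF z (S z.1 z.2 (p ∘L tangentInr IB IF z))) = _
  rw [map_add, mfderiv_fst_tangentInl, mfderiv_fst_tangentInr, add_zero]

theorem mfderiv_snd_blockDiag (p : TangentSpace (IB.prod IF) z →L[ℝ] ℝ) :
    mfderiv (IB.prod IF) IF Prod.snd z (blockDiag T S z p) =
      S z.1 z.2 (p ∘L tangentInr IB IF z) := by
  change mfderiv (IB.prod IF) IF Prod.snd z
    (tangentInl IB IF z (T z.2 z.1 (p ∘L tangentInl IB IF z))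
      + tangentInr IB IF z (S z.1 z.2 (p ∘L tangentInr IB IF z))) = _
  rw [map_add, mfderiv_snd_tangentInl, mfderiv_snd_tangentInr, zero_add]

theorem baseBlock_blockDiag (y : F) : baseBlock (blockDiag T S) y = T y := by
  funext b
  ext1 p
  refine (mfderiv_fst_blockDiag T S (z := (b, y))
    (p ∘L mfderiv (IB.prod IF) IB Prod.fst (b, y))).trans ?_
  rw [ContinuousLinearMap.comp_assoc, mfderiv_fst_comp_tangentInl, ContinuousLinearMap.comp_id]

theorem fiberBlock_blockDiag (b : B) : fiberBlock (blockDiag T S) b = S b := by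
  funext y
  ext1 p
  refine (mfderiv_snd_blockDiag T S (z := (b, y))
    (p ∘L mfderiv (IB.prod IF) IF Prod.snd (b, y))).trans ?_
  rw [ContinuousLinearMap.comp_assoc, mfderiv_snd_comp_tangentInr, ContinuousLinearMap.comp_id]

theorem isBlockDiagonal_blockDiag : IsBlockDiagonal (blockDiag T S) where
  mfderiv_snd_eq_zero z p := by
    rw [mfderiv_snd_blockDiag, ContinuousLinearMap.comp_assoc, mfderiv_fst_comp_tangentInr,
      ContinuousLinearMap.comp_zero, map_zero]
  mfderiv_fst_eq_zero z q := by
    rw [mfderiv_fst_blockDiag, ContinuousLinearMap.comp_assoc, mfderiv_snd_comp_tangentInl,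
      ContinuousLinearMap.comp_zero, map_zero]

theorem IsBlockDiagonal.eq_blockDiag {K : ContraTensor (IB.prod IF) (B × F)}
    (hK : IsBlockDiagonal K) : K = blockDiag (baseBlock K) (fiberBlock K) := by
  funext z
  ext1 p
  refine tangent_prod_ext ?_ ?_
  · rw [hK.mfderiv_fst_apply, mfderiv_fst_blockDiag]
  · rw [hK.mfderiv_snd_apply, mfderiv_snd_blockDiag]

theorem IsBlockDiagonal.eq_blockDiag_iff {K : ContraTensor (IB.prod IF) (B × F)}
    (hK : IsBlockDiagonal K) : K = blockDiag T S ↔ baseBlock K = T ∧ fiberBlock K = S := by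
  refine ⟨?_, ?_⟩
  · rintro rfl
    exact ⟨funext (baseBlock_blockDiag T S), funext (fiberBlock_blockDiag T S)⟩
  · rintro ⟨rfl, rfl⟩
    exact hK.eq_blockDiag

theorem liftBase_add_smul_liftFiber_add_liftFiber (T : ContraTensor IB B) (c : B → ℝ)
    (S R : ContraTensor IF F) :
    (fun z : B × F ↦ liftBase IB IF T z + c z.1 • liftFiber IB IF S z + liftFiber IB IF R z) =
      blockDiag (fun _ ↦ T) fun b ↦ c b • S + R := by
  funext z
  ext1 p
  simp [blockDiag, liftFiber, pushforward, add_assoc]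

end Lifts

/-! ### Smoothness of block-diagonal tensor fields -/

section BlockSmooth

variable {EB : Type*} [NormedAddCommGroup EB] [NormedSpace ℝ EB]
  {HB : Type*} [TopologicalSpace HB] {IB : ModelWithCorners ℝ EB HB}
  {B : Type*} [TopologicalSpace B] [ChartedSpace HB B]
  {EF : Type*} [NormedAddCommGroup EF] [NormedSpace ℝ EF]
  {HF : Type*} [TopologicalSpace HF] {IF : ModelWithCorners ℝ EF HF}
  {F : Type*} [TopologicalSpace F] [ChartedSpace HF F]
  {K : ContraTensor (IB.prod IF) (B × F)} {z : B × F}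

theorem IsBlockDiagonal.contraction_add_add (hK : IsBlockDiagonal K) {f h : B → ℝ}
    {f' h' : F → ℝ} (hf : MDiffAt f z.1) (hh : MDiffAt h z.1) (hf' : MDiffAt f' z.2)
    (hh' : MDiffAt h' z.2) :
    contraction (IB.prod IF) K (f ∘ Prod.fst + f' ∘ Prod.snd) (h ∘ Prod.fst + h' ∘ Prod.snd) z =
      contraction IB (baseBlock K z.2) f h z.1 + contraction IF (fiberBlock K z.1) f' h' z.2 := by
  have hcross := hK.contraction_fst_snd hf hh'
  have hcross' := hK.contraction_snd_fst hh hf'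
  rw [← contraction_fst_fst K hf hh, ← contraction_snd_snd K hf' hh']
  simp only [contraction] at hcross hcross' ⊢
  rw [mvfderiv_add (hf.comp z mdifferentiableAt_fst) (hf'.comp z mdifferentiableAt_snd),
    mvfderiv_add (hh.comp z mdifferentiableAt_fst) (hh'.comp z mdifferentiableAt_snd), map_add,
    map_add, add_apply, add_apply, hcross, hcross',
    add_zero, zero_add]

theorem functional_comp_extChartAt_prod (z₀ : B × F) (p : EB × EF →L[ℝ] ℝ) :
    p ∘ extChartAt (IB.prod IF) z₀ =
      ((p ∘L .inl ℝ EB EF) ∘ extChartAt IB z₀.1) ∘ Prod.fst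
        + ((p ∘L .inr ℝ EB EF) ∘ extChartAt IF z₀.2) ∘ Prod.snd := by
  funext z
  change p (extChartAt IB z₀.1 z.1, extChartAt IF z₀.2 z.2) =
    p (extChartAt IB z₀.1 z.1, 0) + p (0, extChartAt IF z₀.2 z.2)
  rw [← map_add, Prod.mk_add_mk, add_zero, zero_add]

section Blocks

variable [IsManifold IB ∞ B] [IsManifold IF ∞ F]

theorem IsBlockDiagonal.contraction_extChartAt_eventuallyEq (hK : IsBlockDiagonal K) (z₀ : B × F)
    (p q : EB × EF →L[ℝ] ℝ) :
    contraction (IB.prod IF) K (p ∘ extChartAt (IB.prod IF) z₀) (q ∘ extChartAt (IB.prod IF) z₀)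
      =ᶠ[𝓝 z₀] fun z ↦
        contraction IB (baseBlock K z.2) ((p ∘L .inl ℝ EB EF) ∘ extChartAt IB z₀.1)
          ((q ∘L .inl ℝ EB EF) ∘ extChartAt IB z₀.1) z.1
        + contraction IF (fiberBlock K z.1) ((p ∘L .inr ℝ EB EF) ∘ extChartAt IF z₀.2)
          ((q ∘L .inr ℝ EB EF) ∘ extChartAt IF z₀.2) z.2 := by
  filter_upwards [extChartAt_source_mem_nhds (I := IB.prod IF) z₀] with z hz
  rw [extChartAt_prod] at hz
  have hbase (r : EB →L[ℝ] ℝ) : MDiffAt (r ∘ extChartAt IB z₀.1) z.1 :=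
    (contMDiffAt_functional_comp_extChartAt hz.1 r).mdifferentiableAt (by simp)
  have hfiber (r : EF →L[ℝ] ℝ) : MDiffAt (r ∘ extChartAt IF z₀.2) z.2 :=
    (contMDiffAt_functional_comp_extChartAt hz.2 r).mdifferentiableAt (by simp)
  rw [functional_comp_extChartAt_prod, functional_comp_extChartAt_prod,
    hK.contraction_add_add (hbase _) (hbase _) (hfiber _) (hfiber _)]

variable [IB.Boundaryless] [IF.Boundaryless] [FiniteDimensional ℝ EB] [FiniteDimensional ℝ EF]

theorem IsBlockDiagonal.contMDiffAt_contraction (hK : IsBlockDiagonal K)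
    (hbase : ∀ f h : B → ℝ, CMDiffAt ∞ f z.1 → CMDiffAt ∞ h z.1 →
      CMDiffAt ∞ (fun z' : B × F ↦ contraction IB (baseBlock K z'.2) f h z'.1) z)
    (hfiber : ∀ f h : F → ℝ, CMDiffAt ∞ f z.2 → CMDiffAt ∞ h z.2 →
      CMDiffAt ∞ (fun z' : B × F ↦ contraction IF (fiberBlock K z'.1) f h z'.2) z)
    {f h : B × F → ℝ} (hf : CMDiffAt ∞ f z) (hh : CMDiffAt ∞ h z) :
    CMDiffAt ∞ (contraction (IB.prod IF) K f h) z := by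
  refine contMDiffAt_contraction_of_tensorInChart (contMDiffAt_tensorInChart fun p q ↦ ?_) hf hh
  have hbaseChart := contMDiffAt_functional_comp_extChartAt (mem_extChartAt_source (I := IB) z.1)
  have hfiberChart := contMDiffAt_functional_comp_extChartAt (mem_extChartAt_source (I := IF) z.2)
  exact ((hbase _ _ (hbaseChart _) (hbaseChart _)).add
    (hfiber _ _ (hfiberChart _) (hfiberChart _))).congr_of_eventuallyEq
      (hK.contraction_extChartAt_eventuallyEq z p q)

end Blocks

/-- The tensor field `G₀ + κ G₁` on `B × F`, for `G₀` on `B`, `G₁` on `F` and a function `κ`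
on `B`. It is the contravariant metric of a warped product when `κ = ρ⁻²`. -/
def warpedContra (G₀ : ContraTensor IB B) (G₁ : ContraTensor IF F) (κ : B → ℝ) :
    ContraTensor (IB.prod IF) (B × F) :=
  blockDiag (fun _ ↦ G₀) fun b ↦ κ b • G₁

variable (G₀ : ContraTensor IB B) (G₁ : ContraTensor IF F) (κ : B → ℝ)

theorem isBlockDiagonal_warpedContra : IsBlockDiagonal (warpedContra G₀ G₁ κ) :=
  isBlockDiagonal_blockDiag _ _

theorem baseBlock_warpedContra (y : F) : baseBlock (warpedContra G₀ G₁ κ) y = G₀ :=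
  baseBlock_blockDiag _ _ y

theorem fiberBlock_warpedContra (b : B) : fiberBlock (warpedContra G₀ G₁ κ) b = κ b • G₁ :=
  fiberBlock_blockDiag _ _ b

theorem liftFiber_eq_warpedContra :
    (liftFiber IB IF G₁ : ContraTensor (IB.prod IF) (B × F)) = warpedContra 0 G₁ fun _ ↦ 1 := by
  funext z
  ext1 p
  simp [warpedContra, blockDiag, liftBase, liftFiber, pushforward]

variable {G₀ G₁ κ} [IsManifold IB ∞ B] [IsManifold IF ∞ F]
  [IB.Boundaryless] [IF.Boundaryless] [FiniteDimensional ℝ EB] [FiniteDimensional ℝ EF]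

theorem isSymmetricTensorField_warpedContra (hG₀ : IsSymmetricTensorField IB G₀)
    (hG₁ : IsSymmetricTensorField IF G₁) (hκ : CMDiff ∞ κ) :
    IsSymmetricTensorField (IB.prod IF) (warpedContra G₀ G₁ κ) where
  symm z p q := by
    rw [(isBlockDiagonal_warpedContra G₀ G₁ κ).apply_apply,
      (isBlockDiagonal_warpedContra G₀ G₁ κ).apply_apply]
    simp only [baseBlock_warpedContra, fiberBlock_warpedContra, Pi.smul_apply, smul_apply,
      map_smul]
    rw [hG₀.symm, hG₁.symm]
  smooth z f h hf hh := by
    refine (isBlockDiagonal_warpedContra G₀ G₁ κ).contMDiffAt_contraction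
      (fun f h hf hh ↦ ?_) (fun f h hf hh ↦ ?_) hf hh
    · simp only [baseBlock_warpedContra]
      exact contMDiffAt_comp_fst (hG₀.contMDiffAt hf hh)
    · have hfactor : (fun z : B × F ↦ contraction IF (fiberBlock (warpedContra G₀ G₁ κ) z.1) f h
          z.2) = (κ ∘ Prod.fst) * (contraction IF G₁ f h ∘ Prod.snd) := by
        funext z
        simp [contraction, fiberBlock_warpedContra]
      rw [hfactor]
      exact (contMDiffAt_comp_fst (hκ z.1)).mul (contMDiffAt_comp_snd (hG₁.contMDiffAt hf hh))

end BlockSmooth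

/-! ### The Killing equation on a warped product -/

section Warped

variable {EB : Type*} [NormedAddCommGroup EB] [NormedSpace ℝ EB]
  {HB : Type*} [TopologicalSpace HB] {IB : ModelWithCorners ℝ EB HB}
  {B : Type*} [TopologicalSpace B] [ChartedSpace HB B]
  {EF : Type*} [NormedAddCommGroup EF] [NormedSpace ℝ EF]
  {HF : Type*} [TopologicalSpace HF] {IF : ModelWithCorners ℝ EF HF}
  {F : Type*} [TopologicalSpace F] [ChartedSpace HF F]
  {K : ContraTensor (IB.prod IF) (B × F)}
  {gB : CovTensor IB B} {gF : CovTensor IF F} {ρ : B → ℝ}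

namespace IsSymmetricTensorField

theorem baseBlock [IsManifold IB ∞ B] (hK : IsSymmetricTensorField (IB.prod IF) K) (y : F) :
    IsSymmetricTensorField IB (baseBlock K y) where
  symm b p q := hK.symm (b, y) (p ∘L mfderiv (IB.prod IF) IB Prod.fst (b, y))
    (q ∘L mfderiv (IB.prod IF) IB Prod.fst (b, y))
  smooth b _ _ hf hh := by
    have hsmooth := hK.contMDiffAt (x := (b, y)) (contMDiffAt_comp_fst hf) (contMDiffAt_comp_fst hh)
    have hslice := hsmooth.comp b (contMDiffAt_id.prodMk contMDiffAt_const)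
    exact hslice.congr_of_eventuallyEq (contraction_fst_fst_slice_eventuallyEq K y hf hh).symm

theorem fiberBlock [IsManifold IF ∞ F] (hK : IsSymmetricTensorField (IB.prod IF) K) (b : B) :
    IsSymmetricTensorField IF (fiberBlock K b) where
  symm y p q := hK.symm (b, y) (p ∘L mfderiv (IB.prod IF) IF Prod.snd (b, y))
    (q ∘L mfderiv (IB.prod IF) IF Prod.snd (b, y))
  smooth y _ _ hf hh := by
    have hsmooth := hK.contMDiffAt (x := (b, y)) (contMDiffAt_comp_snd hf) (contMDiffAt_comp_snd hh)
    have hslice := hsmooth.comp y (contMDiffAt_const.prodMk contMDiffAt_id)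
    exact hslice.congr_of_eventuallyEq (contraction_snd_snd_slice_eventuallyEq K b hf hh).symm

theorem contMDiff_contraction_baseBlock (hK : IsSymmetricTensorField (IB.prod IF) K) {b : B}
    {f h : B → ℝ} (hf : CMDiffAt ∞ f b) (hh : CMDiffAt ∞ h b) :
    CMDiff ∞ (fun y ↦ contraction IB (WarpedKilling.baseBlock K y) f h b) := by
  intro y
  have hsmooth := hK.contMDiffAt (x := (b, y)) (contMDiffAt_comp_fst hf) (contMDiffAt_comp_fst hh)
  refine (hsmooth.comp y (contMDiffAt_const.prodMk contMDiffAt_id)).congr_of_eventuallyEq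
    (.of_forall fun y' ↦ ?_)
  exact (contraction_fst_fst K (z := (b, y')) (hf.mdifferentiableAt (by simp))
    (hh.mdifferentiableAt (by simp))).symm

theorem contMDiff_contraction_fiberBlock (hK : IsSymmetricTensorField (IB.prod IF) K) {y : F}
    {f h : F → ℝ} (hf : CMDiffAt ∞ f y) (hh : CMDiffAt ∞ h y) :
    CMDiff ∞ (fun b ↦ contraction IF (WarpedKilling.fiberBlock K b) f h y) := by
  intro b
  have hsmooth := hK.contMDiffAt (x := (b, y)) (contMDiffAt_comp_snd hf) (contMDiffAt_comp_snd hh)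
  refine (hsmooth.comp b (contMDiffAt_id.prodMk contMDiffAt_const)).congr_of_eventuallyEq
    (.of_forall fun b' ↦ ?_)
  exact (contraction_snd_snd K (z := (b', y)) (hf.mdifferentiableAt (by simp))
    (hh.mdifferentiableAt (by simp))).symm

end IsSymmetricTensorField

theorem contMDiff_inv_sq (hρ : CMDiff ∞ ρ) (hρ₀ : ∀ b, ρ b ≠ 0) :
    CMDiff ∞ (fun b ↦ (ρ b ^ 2)⁻¹) := fun b ↦
  ((contDiffAt_id.pow 2).inv (pow_ne_zero 2 (hρ₀ b))).contMDiffAt.comp b (hρ b)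

theorem warpedMetric_apply (gB : CovTensor IB B) (gF : CovTensor IF F) (ρ : B → ℝ) (z : B × F)
    (v : TangentSpace (IB.prod IF) z) : warpedMetric IB IF gB gF ρ z v =
      gB z.1 (mfderiv (IB.prod IF) IB Prod.fst z v) ∘L mfderiv (IB.prod IF) IB Prod.fst z
      + ρ z.1 ^ 2 • (gF z.2 (mfderiv (IB.prod IF) IF Prod.snd z v) ∘L
        mfderiv (IB.prod IF) IF Prod.snd z) := rfl

theorem warpedMetric_comp_tangentInl (z : B × F) (v : TangentSpace (IB.prod IF) z) :
    warpedMetric IB IF gB gF ρ z v ∘L tangentInl IB IF z =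
      gB z.1 (mfderiv (IB.prod IF) IB Prod.fst z v) := by
  rw [warpedMetric_apply, ContinuousLinearMap.add_comp, ContinuousLinearMap.smul_comp,
    ContinuousLinearMap.comp_assoc, ContinuousLinearMap.comp_assoc, mfderiv_fst_comp_tangentInl,
    mfderiv_snd_comp_tangentInl, ContinuousLinearMap.comp_zero, smul_zero, add_zero,
    ContinuousLinearMap.comp_id]

theorem warpedMetric_comp_tangentInr (z : B × F) (v : TangentSpace (IB.prod IF) z) :
    warpedMetric IB IF gB gF ρ z v ∘L tangentInr IB IF z =
      ρ z.1 ^ 2 • gF z.2 (mfderiv (IB.prod IF) IF Prod.snd z v) := by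
  rw [warpedMetric_apply, ContinuousLinearMap.add_comp, ContinuousLinearMap.smul_comp,
    ContinuousLinearMap.comp_assoc, ContinuousLinearMap.comp_assoc, mfderiv_fst_comp_tangentInr,
    mfderiv_snd_comp_tangentInr, ContinuousLinearMap.comp_zero, zero_add,
    ContinuousLinearMap.comp_id]

variable [FiniteDimensional ℝ EB] [FiniteDimensional ℝ EF] [IsManifold IB ∞ B] [IsManifold IF ∞ F]

theorem cometric_warpedMetric (hB : IsPseudoRiemannianMetric IB gB)
    (hF : IsPseudoRiemannianMetric IF gF) (hρ₀ : ∀ b, ρ b ≠ 0) :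
    cometric (IB.prod IF) (warpedMetric IB IF gB gF ρ) =
      warpedContra (cometric IB gB) (cometric IF gF) fun b ↦ (ρ b ^ 2)⁻¹ := by
  funext z
  have hρz : ρ z.1 ^ 2 ≠ 0 := pow_ne_zero 2 (hρ₀ z.1)
  refine ContinuousLinearMap.inverse_eq ?_ ?_
  · ext1 p
    rw [ContinuousLinearMap.comp_apply, warpedMetric_apply, warpedContra, mfderiv_fst_blockDiag,
      mfderiv_snd_blockDiag, Pi.smul_apply, smul_apply, map_smul, hB.apply_cometric,
      hF.apply_cometric, ContinuousLinearMap.smul_comp, smul_smul, mul_inv_cancel₀ hρz, one_smul,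
      ← covector_eq_add]
    rfl
  · ext1 v
    refine tangent_prod_ext ?_ ?_
    · rw [ContinuousLinearMap.comp_apply, warpedContra, mfderiv_fst_blockDiag,
        warpedMetric_comp_tangentInl, hB.cometric_apply]
      rfl
    · rw [ContinuousLinearMap.comp_apply, warpedContra, mfderiv_snd_blockDiag,
        warpedMetric_comp_tangentInr, Pi.smul_apply, smul_apply, map_smul, hF.cometric_apply,
        smul_smul, inv_mul_cancel₀ hρz, one_smul]
      rfl

end Warped

section WarpedKillingEquation

variable {EB : Type*} [NormedAddCommGroup EB] [NormedSpace ℝ EB]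
  {HB : Type*} [TopologicalSpace HB] {IB : ModelWithCorners ℝ EB HB}
  {B : Type*} [TopologicalSpace B] [ChartedSpace HB B]
  {EF : Type*} [NormedAddCommGroup EF] [NormedSpace ℝ EF]
  {HF : Type*} [TopologicalSpace HF] {IF : ModelWithCorners ℝ EF HF}
  {F : Type*} [TopologicalSpace F] [ChartedSpace HF F]

/-- The components of the Killing equation `[K, G₀ + κ G₁] = 0` on `B × F`, where `G₀` and `G₁` are
the contravariant metrics of `gB` and `gF`, for a block-diagonal tensor field `K`: three arguments
on `B`, three on `F`, one on `F` and two on `B`, one on `B` and two on `F`. -/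
structure BlockKillingEquations (gB : CovTensor IB B) (gF : CovTensor IF F) (κ : B → ℝ)
    (K : ContraTensor (IB.prod IF) (B × F)) : Prop where
  base_killing : ∀ y, KillingEquationOn IB gB (baseBlock K y) Set.univ
  fiber_killing : ∀ b, KillingEquationOn IF gF (fiberBlock K b) Set.univ
  mvfderiv_baseBlock : ∀ (b : B) (f h : B → ℝ), CMDiffAt ∞ f b → CMDiffAt ∞ h b →
    ∀ y, d% (fun y ↦ contraction IB (baseBlock K y) f h b) y = 0
  mvfderiv_fiberBlock : ∀ (y : F) (f h : F → ℝ), CMDiffAt ∞ f y → CMDiffAt ∞ h y →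
    ∀ b, d% (fun b ↦ contraction IF (fiberBlock K b) f h y) b =
      contraction IF (cometric IF gF) f h y • gB b (baseBlock K y b (d% κ b))

variable [IsManifold IB ∞ B] [IsManifold IF ∞ F] [IB.Boundaryless] [IF.Boundaryless]
  [FiniteDimensional ℝ EB] [FiniteDimensional ℝ EF]

section Components

variable {K : ContraTensor (IB.prod IF) (B × F)} {G₀ : ContraTensor IB B} {G₁ : ContraTensor IF F}
  {κ : B → ℝ} {z : B × F}

theorem schouten_warpedContra_fst_fst_fst (hK : IsSymmetricTensorField (IB.prod IF) K)
    (hKb : IsBlockDiagonal K) (hG₀ : IsSymmetricTensorField IB G₀)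
    (hG₁ : IsSymmetricTensorField IF G₁) (hκ : CMDiff ∞ κ) {f₁ f₂ f₃ : B → ℝ}
    (hf₁ : CMDiffAt ∞ f₁ z.1) (hf₂ : CMDiffAt ∞ f₂ z.1) (hf₃ : CMDiffAt ∞ f₃ z.1) :
    schouten (IB.prod IF) K (warpedContra G₀ G₁ κ)
        (f₁ ∘ Prod.fst) (f₂ ∘ Prod.fst) (f₃ ∘ Prod.fst) z =
      schouten IB (baseBlock K z.2) G₀ f₁ f₂ f₃ z.1 := by
  rw [schouten_fst_fst_fst hK (isSymmetricTensorField_warpedContra hG₀ hG₁ hκ) hKb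
    (isBlockDiagonal_warpedContra G₀ G₁ κ) hf₁ hf₂ hf₃, baseBlock_warpedContra]

theorem schouten_warpedContra_snd_snd_snd (hK : IsSymmetricTensorField (IB.prod IF) K)
    (hKb : IsBlockDiagonal K) (hG₀ : IsSymmetricTensorField IB G₀)
    (hG₁ : IsSymmetricTensorField IF G₁) (hκ : CMDiff ∞ κ) {f₁ f₂ f₃ : F → ℝ}
    (hf₁ : CMDiffAt ∞ f₁ z.2) (hf₂ : CMDiffAt ∞ f₂ z.2) (hf₃ : CMDiffAt ∞ f₃ z.2) :
    schouten (IB.prod IF) K (warpedContra G₀ G₁ κ)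
        (f₁ ∘ Prod.snd) (f₂ ∘ Prod.snd) (f₃ ∘ Prod.snd) z =
      κ z.1 * schouten IF (fiberBlock K z.1) G₁ f₁ f₂ f₃ z.2 := by
  rw [schouten_snd_snd_snd hK (isSymmetricTensorField_warpedContra hG₀ hG₁ hκ) hKb
    (isBlockDiagonal_warpedContra G₀ G₁ κ) hf₁ hf₂ hf₃, fiberBlock_warpedContra,
    schouten_const_smul_right hG₁ _ hf₁ hf₂ hf₃]

theorem schouten_warpedContra_snd_fst_fst (hK : IsSymmetricTensorField (IB.prod IF) K)
    (hKb : IsBlockDiagonal K) (hG₀ : IsSymmetricTensorField IB G₀)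
    (hG₁ : IsSymmetricTensorField IF G₁) (hκ : CMDiff ∞ κ) {u : F → ℝ} {f h : B → ℝ}
    (hu : CMDiffAt ∞ u z.2) (hf : CMDiffAt ∞ f z.1) (hh : CMDiffAt ∞ h z.1) :
    schouten (IB.prod IF) K (warpedContra G₀ G₁ κ)
        (u ∘ Prod.snd) (f ∘ Prod.fst) (h ∘ Prod.fst) z =
      -(2 / 3 : ℝ) * κ z.1 *
        d% (fun y ↦ contraction IB (baseBlock K y) f h z.1) z.2 (G₁ z.2 (d% u z.2)) := by
  rw [schouten_snd_fst_fst hK (isSymmetricTensorField_warpedContra hG₀ hG₁ hκ) hKb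
    (isBlockDiagonal_warpedContra G₀ G₁ κ) hu hf hh, fiberBlock_warpedContra]
  simp only [baseBlock_warpedContra, mvfderiv_const, zero_apply, Pi.smul_apply, smul_apply,
    map_smul, smul_eq_mul]
  ring

theorem schouten_warpedContra_fst_snd_snd (hK : IsSymmetricTensorField (IB.prod IF) K)
    (hKb : IsBlockDiagonal K) (hG₀ : IsSymmetricTensorField IB G₀)
    (hG₁ : IsSymmetricTensorField IF G₁) (hκ : CMDiff ∞ κ) {u : B → ℝ} {f h : F → ℝ}
    (hu : CMDiffAt ∞ u z.1) (hf : CMDiffAt ∞ f z.2) (hh : CMDiffAt ∞ h z.2) :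
    schouten (IB.prod IF) K (warpedContra G₀ G₁ κ)
        (u ∘ Prod.fst) (f ∘ Prod.snd) (h ∘ Prod.snd) z =
      (2 / 3 : ℝ) * (contraction IF G₁ f h z.2 * d% κ z.1 (baseBlock K z.2 z.1 (d% u z.1))
        - d% (fun b ↦ contraction IF (fiberBlock K b) f h z.2) z.1 (G₀ z.1 (d% u z.1))) := by
  have hcontr : (fun b ↦ contraction IF (fiberBlock (warpedContra G₀ G₁ κ) b) f h z.2) =
      contraction IF G₁ f h z.2 • κ := by
    funext b
    rw [fiberBlock_warpedContra, contraction_const_smul]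
    exact mul_comm _ _
  rw [schouten_fst_snd_snd hK (isSymmetricTensorField_warpedContra hG₀ hG₁ hκ) hKb
    (isBlockDiagonal_warpedContra G₀ G₁ κ) hu hf hh, baseBlock_warpedContra, hcontr,
    mvfderiv_const_smul ((hκ z.1).mdifferentiableAt (by simp)), smul_apply, smul_eq_mul]

end Components

variable {gB : CovTensor IB B} {gF : CovTensor IF F} {ρ : B → ℝ}
  {K : ContraTensor (IB.prod IF) (B × F)}

theorem schouten_warpedContra_cometric_fst_snd_snd (hB : IsPseudoRiemannianMetric IB gB)
    (hF : IsPseudoRiemannianMetric IF gF) {κ : B → ℝ} (hκ : CMDiff ∞ κ)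
    (hK : IsSymmetricTensorField (IB.prod IF) K) (hKb : IsBlockDiagonal K) {z : B × F}
    {u : B → ℝ} {f h : F → ℝ} (hu : CMDiffAt ∞ u z.1) (hf : CMDiffAt ∞ f z.2)
    (hh : CMDiffAt ∞ h z.2) :
    schouten (IB.prod IF) K (warpedContra (cometric IB gB) (cometric IF gF) κ)
        (u ∘ Prod.fst) (f ∘ Prod.snd) (h ∘ Prod.snd) z =
      (2 / 3 : ℝ) *
        (contraction IF (cometric IF gF) f h z.2 • gB z.1 (baseBlock K z.2 z.1 (d% κ z.1))
          - d% (fun b ↦ contraction IF (fiberBlock K b) f h z.2) z.1)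
        (cometric IB gB z.1 (d% u z.1)) := by
  have hadjoint : d% κ z.1 (baseBlock K z.2 z.1 (d% u z.1)) =
      gB z.1 (baseBlock K z.2 z.1 (d% κ z.1)) (cometric IB gB z.1 (d% u z.1)) := by
    rw [hB.symm, hB.apply_cometric, (hK.baseBlock z.2).symm]
  rw [schouten_warpedContra_fst_snd_snd hK hKb hB.isSymmetricTensorField_cometric
    hF.isSymmetricTensorField_cometric hκ hu hf hh, hadjoint]
  rfl

theorem KillingEquationOn.blockKillingEquations (hB : IsPseudoRiemannianMetric IB gB)
    (hF : IsPseudoRiemannianMetric IF gF) (hρ : CMDiff ∞ ρ) (hρ₀ : ∀ b, ρ b ≠ 0)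
    (hK : IsSymmetricTensorField (IB.prod IF) K) (hKb : IsBlockDiagonal K)
    (hkill : KillingEquationOn (IB.prod IF) (warpedMetric IB IF gB gF ρ) K Set.univ) :
    BlockKillingEquations gB gF (fun b ↦ (ρ b ^ 2)⁻¹) K := by
  have hκ := contMDiff_inv_sq hρ hρ₀
  have hκ₀ (b : B) : (ρ b ^ 2)⁻¹ ≠ 0 := inv_ne_zero (pow_ne_zero 2 (hρ₀ b))
  have hG₀ := hB.isSymmetricTensorField_cometric
  have hG₁ := hF.isSymmetricTensorField_cometric
  rw [KillingEquationOn, cometric_warpedMetric hB hF hρ₀] at hkill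
  refine ⟨fun y b _ f₁ f₂ f₃ hf₁ hf₂ hf₃ ↦ ?_, fun b y _ f₁ f₂ f₃ hf₁ hf₂ hf₃ ↦ ?_,
    fun b f h hf hh y ↦ ?_, fun y f h hf hh b ↦ ?_⟩
  · rw [← schouten_warpedContra_fst_fst_fst (z := (b, y)) hK hKb hG₀ hG₁ hκ hf₁ hf₂ hf₃]
    exact hkill _ trivial _ _ _ (contMDiffAt_comp_fst hf₁) (contMDiffAt_comp_fst hf₂)
      (contMDiffAt_comp_fst hf₃)
  · have hFFF := hkill (b, y) trivial _ _ _ (contMDiffAt_comp_snd hf₁) (contMDiffAt_comp_snd hf₂)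
      (contMDiffAt_comp_snd hf₃)
    rw [schouten_warpedContra_snd_snd_snd hK hKb hG₀ hG₁ hκ hf₁ hf₂ hf₃] at hFFF
    exact (mul_eq_zero.1 hFFF).resolve_left (hκ₀ b)
  · ext v
    obtain ⟨u, hu, hdu⟩ := exists_mvfderiv_eq y (gF y v)
    have hFBB := hkill (b, y) trivial _ _ _ (contMDiffAt_comp_snd hu) (contMDiffAt_comp_fst hf)
      (contMDiffAt_comp_fst hh)
    rw [schouten_warpedContra_snd_fst_fst hK hKb hG₀ hG₁ hκ hu hf hh, hdu,
      hF.cometric_apply] at hFBB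
    exact (mul_eq_zero.1 hFBB).resolve_left (mul_ne_zero (by norm_num) (hκ₀ b))
  · ext v
    obtain ⟨u, hu, hdu⟩ := exists_mvfderiv_eq b (gB b v)
    have hBFF := hkill (b, y) trivial _ _ _ (contMDiffAt_comp_fst hu) (contMDiffAt_comp_snd hf)
      (contMDiffAt_comp_snd hh)
    rw [schouten_warpedContra_cometric_fst_snd_snd hB hF hκ hK hKb hu hf hh, hdu,
      hB.cometric_apply] at hBFF
    exact (sub_eq_zero.1 ((mul_eq_zero.1 hBFF).resolve_left (by norm_num))).symm

theorem BlockKillingEquations.killingEquationOn (hB : IsPseudoRiemannianMetric IB gB)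
    (hF : IsPseudoRiemannianMetric IF gF) (hρ : CMDiff ∞ ρ) (hρ₀ : ∀ b, ρ b ≠ 0)
    (hK : IsSymmetricTensorField (IB.prod IF) K) (hKb : IsBlockDiagonal K)
    (hblocks : BlockKillingEquations gB gF (fun b ↦ (ρ b ^ 2)⁻¹) K) :
    KillingEquationOn (IB.prod IF) (warpedMetric IB IF gB gF ρ) K Set.univ := by
  intro z _ f₁ f₂ f₃ hf₁ hf₂ hf₃
  have hκ := contMDiff_inv_sq hρ hρ₀
  have hG₀ := hB.isSymmetricTensorField_cometric
  have hG₁ := hF.isSymmetricTensorField_cometric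
  rw [cometric_warpedMetric hB hF hρ₀]
  refine schouten_eq_zero_of_factors hK (isSymmetricTensorField_warpedContra hG₀ hG₁ hκ)
    (fun u₁ u₂ u₃ hu₁ hu₂ hu₃ ↦ ?_) (fun u f h hu hf hh ↦ ?_) (fun u f h hu hf hh ↦ ?_)
    (fun u₁ u₂ u₃ hu₁ hu₂ hu₃ ↦ ?_) hf₁ hf₂ hf₃
  · rw [schouten_warpedContra_fst_fst_fst hK hKb hG₀ hG₁ hκ hu₁ hu₂ hu₃]
    exact hblocks.base_killing z.2 z.1 trivial _ _ _ hu₁ hu₂ hu₃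
  · rw [schouten_warpedContra_snd_fst_fst hK hKb hG₀ hG₁ hκ hu hf hh,
      hblocks.mvfderiv_baseBlock z.1 f h hf hh, zero_apply, mul_zero]
  · rw [schouten_warpedContra_cometric_fst_snd_snd hB hF hκ hK hKb hu hf hh,
      hblocks.mvfderiv_fiberBlock z.2 f h hf hh, sub_self, zero_apply, mul_zero]
  · rw [schouten_warpedContra_snd_snd_snd hK hKb hG₀ hG₁ hκ hu₁ hu₂ hu₃,
      hblocks.fiber_killing z.1 z.2 trivial _ _ _ hu₁ hu₂ hu₃, mul_zero]

end WarpedKillingEquation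

/-! ### Decomposition of Killing tensors -/

section Decomposition

variable {EB : Type*} [NormedAddCommGroup EB] [NormedSpace ℝ EB]
  {HB : Type*} [TopologicalSpace HB] {IB : ModelWithCorners ℝ EB HB}
  {B : Type*} [TopologicalSpace B] [ChartedSpace HB B]
  {EF : Type*} [NormedAddCommGroup EF] [NormedSpace ℝ EF]
  {HF : Type*} [TopologicalSpace HF] {IF : ModelWithCorners ℝ EF HF}
  {F : Type*} [TopologicalSpace F] [ChartedSpace HF F]
  {gB : CovTensor IB B} {gF : CovTensor IF F} {κ t : B → ℝ}
  {K : ContraTensor (IB.prod IF) (B × F)}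

namespace BlockKillingEquations

theorem exists_potential (hblocks : BlockKillingEquations gB gF κ K)
    (hK : IsSymmetricTensorField (IB.prod IF) K) (b₀ : B) {y : F} {f h : F → ℝ}
    (hf : CMDiffAt ∞ f y) (hh : CMDiffAt ∞ h y) (hfh : contraction IF (cometric IF gF) f h y ≠ 0) :
    ∃ t : B → ℝ, CMDiff ∞ t ∧ t b₀ = 0 ∧ ∀ b, d% t b = gB b (baseBlock K y b (d% κ b)) := by
  set c := contraction IF (cometric IF gF) f h y
  set k : B → ℝ := fun b ↦ contraction IF (fiberBlock K b) f h y
  have hk : CMDiff ∞ k := hK.contMDiff_contraction_fiberBlock hf hh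
  have hdiff (b : B) : MDiffAt (c⁻¹ • k) b :=
    ((hk b).mdifferentiableAt (by simp)).const_smul c⁻¹
  refine ⟨c⁻¹ • k - fun _ ↦ c⁻¹ • k b₀, (contMDiff_const.mul hk).sub contMDiff_const,
    sub_self _, fun b ↦ ?_⟩
  rw [mvfderiv_sub (hdiff b) mdifferentiableAt_const, mvfderiv_const, sub_zero,
    mvfderiv_const_smul ((hk b).mdifferentiableAt (by simp)),
    hblocks.mvfderiv_fiberBlock y f h hf hh, smul_smul, inv_mul_cancel₀ hfh, one_smul]

variable [IsManifold IB ∞ B] [IsManifold IF ∞ F]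

theorem baseBlock_eq [IF.Boundaryless] [PreconnectedSpace F]
    (hblocks : BlockKillingEquations gB gF κ K) (hK : IsSymmetricTensorField (IB.prod IF) K)
    (y y' : F) : baseBlock K y = baseBlock K y' := by
  funext b
  refine tensor_ext fun f h hf hh ↦ ?_
  exact eq_of_mvfderiv_eq_zero
    ((hK.contMDiff_contraction_baseBlock hf hh).mdifferentiable (by simp))
    (hblocks.mvfderiv_baseBlock b f h hf hh) y y'

theorem fiberBlock_eq [IB.Boundaryless] [PreconnectedSpace B]
    (hblocks : BlockKillingEquations gB gF κ K) (hK : IsSymmetricTensorField (IB.prod IF) K)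
    (ht : MDiff t) {b₀ : B} (ht₀ : t b₀ = 0)
    (hdt : ∀ y b, d% t b = gB b (baseBlock K y b (d% κ b))) (b : B) :
    fiberBlock K b = t b • cometric IF gF + fiberBlock K b₀ := by
  funext y
  refine tensor_ext fun f h hf hh ↦ ?_
  change contraction IF (fiberBlock K b) f h y =
    contraction IF (t b • cometric IF gF + fiberBlock K b₀) f h y
  rw [contraction_add, contraction_const_smul]
  set c := contraction IF (cometric IF gF) f h y with hc
  have hk : MDiff (fun b ↦ contraction IF (fiberBlock K b) f h y) :=
    (hK.contMDiff_contraction_fiberBlock hf hh).mdifferentiable (by simp)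
  have hct (b : B) : MDiffAt (c • t) b := (ht b).const_smul c
  have hconst := eq_of_mvfderiv_eq_zero (fun b ↦ (hk b).sub (hct b)) (fun b ↦ by
    rw [mvfderiv_sub (hk b) (hct b), mvfderiv_const_smul (ht b),
      hblocks.mvfderiv_fiberBlock y f h hf hh, hdt y, sub_self]) b b₀
  simp only [Pi.sub_apply, Pi.smul_apply, smul_eq_mul, ht₀, mul_zero, sub_zero] at hconst
  simp only [Pi.add_apply, Pi.smul_apply, smul_eq_mul, ← hc]
  linarith

end BlockKillingEquations

theorem IsPseudoRiemannianMetric.exists_contraction_cometric_ne_zero [IsManifold IF ∞ F]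
    [FiniteDimensional ℝ EF] [Nontrivial EF] (hF : IsPseudoRiemannianMetric IF gF) (y : F) :
    ∃ f h : F → ℝ, CMDiffAt ∞ f y ∧ CMDiffAt ∞ h y ∧
      contraction IF (cometric IF gF) f h y ≠ 0 := by
  obtain ⟨v, p, hpv⟩ : ∃ (v : TangentSpace IF y) (p : TangentSpace IF y →L[ℝ] ℝ), p v ≠ 0 := by
    obtain ⟨v, hv⟩ := exists_ne (0 : EF)
    exact ⟨v, SeparatingDual.exists_ne_zero (R := ℝ) (V := EF) hv⟩
  obtain ⟨f, hf, hdf⟩ := exists_mvfderiv_eq (I := IF) y p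
  obtain ⟨h, hh, hdh⟩ := exists_mvfderiv_eq (I := IF) y (gF y v)
  refine ⟨f, h, hf, hh, ?_⟩
  rw [contraction, hdf, hdh, hF.cometric_apply]
  exact hpv

variable {K' : ContraTensor IB B} {Kt : ContraTensor IF F}

theorem KillingEquationOn.const_smul_cometric_add [IsManifold IF ∞ F] [IF.Boundaryless]
    [FiniteDimensional ℝ EF] (hF : IsPseudoRiemannianMetric IF gF) {s : Set F}
    (hKt : IsSymmetricTensorField IF Kt) (hkill : KillingEquationOn IF gF Kt s) (c : ℝ) :
    KillingEquationOn IF gF (c • cometric IF gF + Kt) s := by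
  intro y hy f₁ f₂ f₃ hf₁ hf₂ hf₃
  have hG₁ := hF.isSymmetricTensorField_cometric
  rw [schouten_add (hG₁.const_smul c) hKt hf₁ hf₂ hf₃, schouten_const_smul_left hG₁ c hf₁ hf₂ hf₃,
    schouten_self, mul_zero, zero_add]
  exact hkill y hy f₁ f₂ f₃ hf₁ hf₂ hf₃

theorem blockKillingEquations_of_blocks [IsManifold IF ∞ F] [IF.Boundaryless]
    [FiniteDimensional ℝ EF] (hF : IsPseudoRiemannianMetric IF gF)
    (hK' : KillingEquationOn IB gB K' Set.univ) (hKt : IsKillingTensor IF gF Kt) (ht : MDiff t)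
    (hdt : ∀ b, d% t b = gB b (K' b (d% κ b))) (hbase : baseBlock K = fun _ ↦ K')
    (hfiber : fiberBlock K = fun b ↦ t b • cometric IF gF + Kt) :
    BlockKillingEquations gB gF κ K where
  base_killing y := by rwa [hbase]
  fiber_killing b := by
    rw [hfiber]
    exact hKt.killing.const_smul_cometric_add hF hKt.isSymmetricTensorField (t b)
  mvfderiv_baseBlock b f h _ _ y := by
    rw [hbase]
    exact mvfderiv_const _
  mvfderiv_fiberBlock y f h _ _ b := by
    have hsplit : (fun b ↦ contraction IF (fiberBlock K b) f h y) =
        contraction IF (cometric IF gF) f h y • t + fun _ ↦ contraction IF Kt f h y := by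
      funext b
      rw [hfiber, contraction_add, contraction_const_smul]
      simp only [Pi.add_apply, Pi.smul_apply, smul_eq_mul, mul_comm]
    rw [hsplit, mvfderiv_add ((ht b).const_smul _) mdifferentiableAt_const,
      mvfderiv_const_smul (ht b), mvfderiv_const, add_zero, hdt, hbase]

variable [IsManifold IB ∞ B] [IsManifold IF ∞ F] [IB.Boundaryless] [IF.Boundaryless]
  [FiniteDimensional ℝ EF]

theorem BlockKillingEquations.exists_decomposition [PreconnectedSpace B] [PreconnectedSpace F]
    [Nonempty B] [Nonempty F] [Nontrivial EF] (hF : IsPseudoRiemannianMetric IF gF)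
    (hK : IsSymmetricTensorField (IB.prod IF) K) (hKb : IsBlockDiagonal K)
    (hblocks : BlockKillingEquations gB gF κ K) :
    ∃ (K' : ContraTensor IB B) (Kt : ContraTensor IF F) (t : B → ℝ),
      IsKillingTensor IB gB K' ∧ IsKillingTensor IF gF Kt ∧ CMDiff ∞ t ∧
      K = blockDiag (fun _ ↦ K') (fun b ↦ t b • cometric IF gF + Kt) ∧
      ∀ b, d% t b = gB b (K' b (d% κ b)) := by
  obtain ⟨b₀⟩ := ‹Nonempty B›
  obtain ⟨y₀⟩ := ‹Nonempty F›
  obtain ⟨f, h, hf, hh, hfh⟩ := hF.exists_contraction_cometric_ne_zero y₀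
  obtain ⟨t, ht, ht₀, hdt⟩ := hblocks.exists_potential hK b₀ hf hh hfh
  have hbase (y : F) : baseBlock K y = baseBlock K y₀ := hblocks.baseBlock_eq hK y y₀
  refine ⟨baseBlock K y₀, fiberBlock K b₀, t, ⟨hK.baseBlock y₀, hblocks.base_killing y₀⟩,
    ⟨hK.fiberBlock b₀, hblocks.fiber_killing b₀⟩, ht,
    (hKb.eq_blockDiag_iff _ _).2 ⟨funext hbase, funext ?_⟩, hdt⟩
  exact hblocks.fiberBlock_eq hK (ht.mdifferentiable (by simp)) ht₀ fun y ↦ by rwa [hbase y]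

variable [FiniteDimensional ℝ EB] {ρ : B → ℝ}

theorem IsKillingTensor.liftFiber (hB : IsPseudoRiemannianMetric IB gB)
    (hF : IsPseudoRiemannianMetric IF gF) (hρ : CMDiff ∞ ρ) (hρ₀ : ∀ b, ρ b ≠ 0)
    (hKt : IsKillingTensor IF gF Kt) :
    IsKillingTensor (IB.prod IF) (warpedMetric IB IF gB gF ρ)
      (liftFiber IB IF Kt : ContraTensor (IB.prod IF) (B × F)) := by
  have hzero : IsSymmetricTensorField IB (0 : ContraTensor IB B) :=
    ⟨fun _ p q ↦ (map_zero p).trans (map_zero q).symm, fun x f h _ _ ↦ by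
      simpa using contMDiffAt_const⟩
  have hsymm := isSymmetricTensorField_warpedContra hzero hKt.isSymmetricTensorField
    contMDiff_const (κ := fun _ ↦ 1)
  rw [liftFiber_eq_warpedContra]
  refine ⟨hsymm, BlockKillingEquations.killingEquationOn hB hF hρ hρ₀ hsymm
    (isBlockDiagonal_warpedContra _ _ _) ?_⟩
  refine blockKillingEquations_of_blocks (K' := 0) (t := 0) hF
    (fun b _ f₁ f₂ f₃ _ _ _ ↦ schouten_zero _ f₁ f₂ f₃ b) hKt (fun _ ↦ mdifferentiableAt_const)
    (fun b ↦ ?_) (funext fun y ↦ baseBlock_warpedContra _ _ _ y) (funext fun b ↦ ?_)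
  · simp [mvfderiv_zero]
  · rw [fiberBlock_warpedContra, Pi.zero_apply, zero_smul, zero_add, one_smul]

theorem killingEquationOn_warpedMetric_iff_exists [PreconnectedSpace B] [PreconnectedSpace F]
    [Nonempty B] [Nonempty F] [Nontrivial EF] (hB : IsPseudoRiemannianMetric IB gB)
    (hF : IsPseudoRiemannianMetric IF gF) (hρ : CMDiff ∞ ρ) (hρ₀ : ∀ b, ρ b ≠ 0)
    (hK : IsSymmetricTensorField (IB.prod IF) K) (hKb : IsBlockDiagonal K) :
    KillingEquationOn (IB.prod IF) (warpedMetric IB IF gB gF ρ) K Set.univ ↔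
      ∃ (K' : ContraTensor IB B) (Kt : ContraTensor IF F) (t : B → ℝ),
        IsKillingTensor IB gB K' ∧ IsKillingTensor IF gF Kt ∧ CMDiff ∞ t ∧
        (∀ z, K z = liftBase IB IF K' z + t z.1 • liftFiber IB IF (cometric IF gF) z
          + liftFiber IB IF Kt z) ∧
        ∀ b, d% t b = gB b (K' b (d% (fun b' ↦ (ρ b' ^ 2)⁻¹) b)) := by
  simp only [← funext_iff (f := K), liftBase_add_smul_liftFiber_add_liftFiber]
  constructor
  · intro hkill
    exact (hkill.blockKillingEquations hB hF hρ hρ₀ hK hKb).exists_decomposition hF hK hKb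
  · rintro ⟨K', Kt, t, hK', hKt, ht, hdecomp, hdt⟩
    obtain ⟨hbase, hfiber⟩ := (hKb.eq_blockDiag_iff _ _).1 hdecomp
    exact (blockKillingEquations_of_blocks hF hK'.killing hKt (ht.mdifferentiable (by simp)) hdt
      hbase hfiber).killingEquationOn hB hF hρ hρ₀ hK hKb

end Decomposition

/-! ### Transport along local diffeomorphisms -/

section Transport

open ContinuousLinearMap (precomp)

variable {E : Type*} [NormedAddCommGroup E] [NormedSpace ℝ E]
  {H : Type*} [TopologicalSpace H] {I : ModelWithCorners ℝ E H}
  {N : Type*} [TopologicalSpace N] [ChartedSpace H N]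
  {E' : Type*} [NormedAddCommGroup E'] [NormedSpace ℝ E']
  {H' : Type*} [TopologicalSpace H'] {J : ModelWithCorners ℝ E' H'}
  {M : Type*} [TopologicalSpace M] [ChartedSpace H' M]
  {φ : N → M} {z : N} {K : ContraTensor J M}

variable (I J) in
/-- Pull-back of a contravariant 2-tensor field by a map with invertible differential. -/
def pullbackContra (φ : N → M) (K : ContraTensor J M) : ContraTensor I N := fun z ↦
  (mfderiv I J φ z).inverse ∘L K (φ z) ∘L precomp ℝ (mfderiv I J φ z).inverse

theorem contraction_congr_of_eventuallyEq (T : ContraTensor I N) {f f' h h' : N → ℝ}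
    (hf : f =ᶠ[𝓝 z] f') (hh : h =ᶠ[𝓝 z] h') :
    contraction I T f h =ᶠ[𝓝 z] contraction I T f' h' := by
  filter_upwards [hf.eventuallyEq_nhds, hh.eventuallyEq_nhds] with y hfy hhy
  rw [contraction, contraction, mvfderiv_congr_of_eventuallyEq hfy,
    mvfderiv_congr_of_eventuallyEq hhy]

theorem schoutenTerm_congr_of_eventuallyEq (K G : ContraTensor I N) {u u' f f' h h' : N → ℝ}
    (hu : u =ᶠ[𝓝 z] u') (hf : f =ᶠ[𝓝 z] f') (hh : h =ᶠ[𝓝 z] h') :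
    schoutenTerm I K G u f h z = schoutenTerm I K G u' f' h' z := by
  rw [schoutenTerm, schoutenTerm, mvfderiv_congr_of_eventuallyEq hu,
    mvfderiv_congr_of_eventuallyEq (contraction_congr_of_eventuallyEq K hf hh),
    mvfderiv_congr_of_eventuallyEq (contraction_congr_of_eventuallyEq G hf hh)]

theorem schouten_congr_of_eventuallyEq (K G : ContraTensor I N) {f₁ f₂ f₃ h₁ h₂ h₃ : N → ℝ}
    (h₁₁ : f₁ =ᶠ[𝓝 z] h₁) (h₂₂ : f₂ =ᶠ[𝓝 z] h₂) (h₃₃ : f₃ =ᶠ[𝓝 z] h₃) :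
    schouten I K G f₁ f₂ f₃ z = schouten I K G h₁ h₂ h₃ z := by
  rw [schouten_eq_sum_schoutenTerm, schouten_eq_sum_schoutenTerm,
    schoutenTerm_congr_of_eventuallyEq K G h₁₁ h₂₂ h₃₃,
    schoutenTerm_congr_of_eventuallyEq K G h₂₂ h₃₃ h₁₁,
    schoutenTerm_congr_of_eventuallyEq K G h₃₃ h₁₁ h₂₂]

theorem isInvertible_mfderiv (hφ : IsLocalDiffeomorph I J ∞ φ) (z : N) :
    (mfderiv I J φ z).IsInvertible :=
  ⟨hφ.mfderivToContinuousLinearEquiv (by simp) z, rfl⟩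

theorem pullbackContra_eq_iff (hφ : IsLocalDiffeomorph I J ∞ φ)
    {T : (TangentSpace I z →L[ℝ] ℝ) →L[ℝ] TangentSpace I z} :
    pullbackContra I J φ K z = T ↔ K (φ z) = pushforward I J φ z T := by
  have hA := isInvertible_mfderiv hφ z
  rw [pullbackContra, pushforward]
  constructor
  · rintro rfl
    ext1 p
    change K (φ z) p = mfderiv I J φ z ((mfderiv I J φ z).inverse (K (φ z)
      ((p ∘L mfderiv I J φ z) ∘L (mfderiv I J φ z).inverse)))
    rw [hA.self_apply_inverse, ContinuousLinearMap.comp_assoc, hA.self_comp_inverse,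
      ContinuousLinearMap.comp_id]
  · intro hKT
    rw [hKT]
    ext1 p
    change (mfderiv I J φ z).inverse (mfderiv I J φ z
      (T ((p ∘L (mfderiv I J φ z).inverse) ∘L mfderiv I J φ z))) = T p
    rw [hA.inverse_apply_self, ContinuousLinearMap.comp_assoc, hA.inverse_comp_self,
      ContinuousLinearMap.comp_id]

theorem pushforward_pullbackContra (hφ : IsLocalDiffeomorph I J ∞ φ) (K : ContraTensor J M)
    (z : N) : K (φ z) = pushforward I J φ z (pullbackContra I J φ K z) :=
  (pullbackContra_eq_iff hφ).1 rfl

theorem pullbackContra_cometric (hφ : IsLocalDiffeomorph I J ∞ φ) (g : CovTensor J M) :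
    pullbackContra I J φ (cometric J g) =
      cometric I fun z ↦ pullback I J φ z (g (φ z)) := by
  funext z
  rw [pullbackContra_eq_iff hφ]
  exact (comp_inverse_comp_precomp (isInvertible_mfderiv hφ z) (g (φ z))).symm

theorem exists_comp_eventuallyEq (hφ : IsLocalDiffeomorph I J ∞ φ) {f : N → ℝ}
    (hf : CMDiffAt ∞ f z) : ∃ f' : M → ℝ, CMDiffAt ∞ f' (φ z) ∧ f' ∘ φ =ᶠ[𝓝 z] f := by
  refine ⟨f ∘ (hφ z).localInverse, ?_, ?_⟩
  · refine ContMDiffAt.comp (φ z) ?_ (hφ z).localInverse_contMDiffAt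
    rwa [(hφ z).localInverse_left_inv (hφ z).localInverse_mem_target]
  · filter_upwards [(hφ z).localInverse_eventuallyEq_left] with y hy
    exact congrArg f hy

variable [IsManifold I ∞ N] [IsManifold J ∞ M]

theorem IsSymmetricTensorField.pullbackContra (hφ : IsLocalDiffeomorph I J ∞ φ)
    (hK : IsSymmetricTensorField J K) : IsSymmetricTensorField I (pullbackContra I J φ K) where
  symm z p q := hK.symm (φ z) (p ∘L (mfderiv I J φ z).inverse) (q ∘L (mfderiv I J φ z).inverse)
  smooth z f h hf hh := by
    obtain ⟨f', hf', hff'⟩ := exists_comp_eventuallyEq hφ hf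
    obtain ⟨h', hh', hhh'⟩ := exists_comp_eventuallyEq hφ hh
    refine ((hK.contMDiffAt hf' hh').comp z (hφ z).contMDiffAt).congr_of_eventuallyEq ?_
    exact (contraction_congr_of_eventuallyEq _ hff'.symm hhh'.symm).trans
      (contraction_comp_eventuallyEq_of_pushforward
        (.of_forall (pushforward_pullbackContra hφ K)) (hφ z).contMDiffAt hf' hh').symm

theorem schouten_pullbackContra (hφ : IsLocalDiffeomorph I J ∞ φ)
    (hK : IsSymmetricTensorField J K) {G : ContraTensor J M} (hG : IsSymmetricTensorField J G)
    {f₁ f₂ f₃ : M → ℝ} (hf₁ : CMDiffAt ∞ f₁ (φ z)) (hf₂ : CMDiffAt ∞ f₂ (φ z))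
    (hf₃ : CMDiffAt ∞ f₃ (φ z)) :
    schouten I (pullbackContra I J φ K) (pullbackContra I J φ G)
      (f₁ ∘ φ) (f₂ ∘ φ) (f₃ ∘ φ) z = schouten J K G f₁ f₂ f₃ (φ z) :=
  (schouten_comp_of_pushforward (.of_forall (pushforward_pullbackContra hφ K))
    (.of_forall (pushforward_pullbackContra hφ G)) (hφ z).contMDiffAt hK hG hf₁ hf₂ hf₃).symm

theorem killingEquationOn_range_iff (hφ : IsLocalDiffeomorph I J ∞ φ)
    (hK : IsSymmetricTensorField J K) {g : CovTensor J M}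
    (hG : IsSymmetricTensorField J (cometric J g)) :
    KillingEquationOn J g K (Set.range φ) ↔
      KillingEquationOn I (fun z ↦ pullback I J φ z (g (φ z))) (pullbackContra I J φ K)
        Set.univ := by
  rw [KillingEquationOn, KillingEquationOn, ← pullbackContra_cometric hφ]
  constructor
  · intro hkill z _ f₁ f₂ f₃ hf₁ hf₂ hf₃
    obtain ⟨f₁', hf₁', h₁⟩ := exists_comp_eventuallyEq hφ hf₁
    obtain ⟨f₂', hf₂', h₂⟩ := exists_comp_eventuallyEq hφ hf₂
    obtain ⟨f₃', hf₃', h₃⟩ := exists_comp_eventuallyEq hφ hf₃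
    rw [← schouten_congr_of_eventuallyEq _ _ h₁ h₂ h₃,
      schouten_pullbackContra hφ hK hG hf₁' hf₂' hf₃']
    exact hkill _ ⟨z, rfl⟩ _ _ _ hf₁' hf₂' hf₃'
  · rintro hkill _ ⟨z, rfl⟩ f₁ f₂ f₃ hf₁ hf₂ hf₃
    rw [← schouten_pullbackContra hφ hK hG hf₁ hf₂ hf₃]
    have hφz := (hφ z).contMDiffAt
    exact hkill z trivial _ _ _ (hf₁.comp z hφz) (hf₂.comp z hφz) (hf₃.comp z hφz)

end Transport

/-! ### Adapted warped products -/

namespace IsAdaptedWarpedProduct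

variable {EB : Type*} [NormedAddCommGroup EB] [NormedSpace ℝ EB]
  {HB : Type*} [TopologicalSpace HB] {IB : ModelWithCorners ℝ EB HB}
  {B : Type*} [TopologicalSpace B] [ChartedSpace HB B] [IsManifold IB ∞ B]
  {EF : Type*} [NormedAddCommGroup EF] [NormedSpace ℝ EF]
  {HF : Type*} [TopologicalSpace HF] {IF : ModelWithCorners ℝ EF HF}
  {F : Type*} [TopologicalSpace F] [ChartedSpace HF F] [IsManifold IF ∞ F]
  {E : Type*} [NormedAddCommGroup E] [NormedSpace ℝ E]
  {H : Type*} [TopologicalSpace H] {I : ModelWithCorners ℝ E H}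
  {M : Type*} [TopologicalSpace M] [ChartedSpace H M]
  {g : CovTensor I M} {D : Distribution I M} {gB : CovTensor IB B} {gF : CovTensor IF F}
  {ρ : B → ℝ} {φ : B × F → M} {K : ContraTensor I M}

theorem mem_iff_exists_tangentInr (hφ : IsAdaptedWarpedProduct IB IF I g D gB gF ρ φ)
    (z : B × F) (v : TangentSpace I (φ z)) :
    v ∈ D (φ z) ↔ ∃ w, mfderiv (IB.prod IF) I φ z (tangentInr IB IF z w) = v := by
  have hcomp : mfderiv IF I (fun y ↦ φ (z.1, y)) z.2 =
      mfderiv (IB.prod IF) I φ z ∘L tangentInr IB IF z :=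
    mfderiv_comp z.2 ((hφ.localDiffeo z).mdifferentiableAt (by simp))
      (mdifferentiableAt_const.prodMk mdifferentiableAt_id)
  rw [← hφ.adapted_fiber z.1 z.2, hcomp]
  exact Iff.rfl

theorem metric_mfderiv_tangentInr (hφ : IsAdaptedWarpedProduct IB IF I g D gB gF ρ φ)
    (z : B × F) (w : TangentSpace IF z.2) :
    g (φ z) (mfderiv (IB.prod IF) I φ z (tangentInr IB IF z w)) ∘L mfderiv (IB.prod IF) I φ z =
      ρ z.1 ^ 2 • (gF z.2 w ∘L mfderiv (IB.prod IF) IF Prod.snd z) := by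
  change pullback (IB.prod IF) I φ z (g (φ z)) (tangentInr IB IF z w) = _
  rw [hφ.isometry, warpedMetric_apply, mfderiv_fst_tangentInr, mfderiv_snd_tangentInr, map_zero,
    ContinuousLinearMap.zero_comp, zero_add]

theorem exists_pullbackContra_eq_tangentInr [FiniteDimensional ℝ EF]
    (hφ : IsAdaptedWarpedProduct IB IF I g D gB gF ρ φ) (hKD : IsInvariant I g K D)
    (z : B × F) (q : TangentSpace IF z.2 →L[ℝ] ℝ) :
    ∃ w, pullbackContra (IB.prod IF) I φ K z (q ∘L mfderiv (IB.prod IF) IF Prod.snd z) =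
      tangentInr IB IF z w := by
  have hA := isInvertible_mfderiv hφ.localDiffeo z
  set v := mfderiv (IB.prod IF) I φ z
    (tangentInr IB IF z ((ρ z.1 ^ 2)⁻¹ • cometric IF gF z.2 q)) with hv
  have hq : q ∘L mfderiv (IB.prod IF) IF Prod.snd z = g (φ z) v ∘L mfderiv (IB.prod IF) I φ z := by
    rw [hv, hφ.metric_mfderiv_tangentInr, map_smul, hφ.metric_fiber.apply_cometric,
      ContinuousLinearMap.smul_comp, smul_inv_smul₀ (pow_ne_zero 2 (hφ.warp_pos z.1).ne')]
  obtain ⟨w, hw⟩ := (hφ.mem_iff_exists_tangentInr z _).1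
    (hKD (φ z) v ((hφ.mem_iff_exists_tangentInr z v).2 ⟨_, rfl⟩))
  refine ⟨w, ?_⟩
  rw [hq]
  change (mfderiv (IB.prod IF) I φ z).inverse (K (φ z) ((g (φ z) v ∘L mfderiv (IB.prod IF) I φ z) ∘L
    (mfderiv (IB.prod IF) I φ z).inverse)) = _
  rw [ContinuousLinearMap.comp_assoc, hA.self_comp_inverse, ContinuousLinearMap.comp_id, ← hw,
    hA.inverse_apply_self]

theorem isBlockDiagonal_pullbackContra [FiniteDimensional ℝ EF]
    (hφ : IsAdaptedWarpedProduct IB IF I g D gB gF ρ φ) (hK : IsSymmetricTensorField I K)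
    (hKD : IsInvariant I g K D) : IsBlockDiagonal (pullbackContra (IB.prod IF) I φ K) := by
  have hfst (z : B × F) (q : TangentSpace IF z.2 →L[ℝ] ℝ) :
      mfderiv (IB.prod IF) IB Prod.fst z (pullbackContra (IB.prod IF) I φ K z
        (q ∘L mfderiv (IB.prod IF) IF Prod.snd z)) = 0 := by
    obtain ⟨w, hw⟩ := hφ.exists_pullbackContra_eq_tangentInr hKD z q
    rw [hw, mfderiv_fst_tangentInr]
  refine ⟨fun z p ↦ ?_, hfst⟩
  refine SeparatingDual.eq_zero_of_forall_dual_eq_zero (R := ℝ) (V := EF) fun q ↦ ?_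
  exact (hK.symm (φ z)
    ((q ∘L mfderiv (IB.prod IF) IF Prod.snd z) ∘L (mfderiv (IB.prod IF) I φ z).inverse)
    ((p ∘L mfderiv (IB.prod IF) IB Prod.fst z) ∘L (mfderiv (IB.prod IF) I φ z).inverse)).trans
    ((congrArg p (hfst z q)).trans (map_zero p))

end IsAdaptedWarpedProduct

end WarpedKilling

end

open WarpedKilling in
theorem mainTheorem2
    {EB : Type*} [NormedAddCommGroup EB] [NormedSpace ℝ EB] [FiniteDimensional ℝ EB]
    {HB : Type*} [TopologicalSpace HB] (IB : ModelWithCorners ℝ EB HB) [IB.Boundaryless]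
    {B : Type*} [TopologicalSpace B] [ChartedSpace HB B] [IsManifold IB ∞ B] [ConnectedSpace B]
    {EF : Type*} [NormedAddCommGroup EF] [NormedSpace ℝ EF] [FiniteDimensional ℝ EF]
    {HF : Type*} [TopologicalSpace HF] (IF : ModelWithCorners ℝ EF HF) [IF.Boundaryless]
    {F : Type*} [TopologicalSpace F] [ChartedSpace HF F] [IsManifold IF ∞ F] [ConnectedSpace F]
    {E : Type*} [NormedAddCommGroup E] [NormedSpace ℝ E] [FiniteDimensional ℝ E]
    {H : Type*} [TopologicalSpace H] (I : ModelWithCorners ℝ E H) [I.Boundaryless]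
    {M : Type*} [TopologicalSpace M] [ChartedSpace H M] [IsManifold I ∞ M]
    (g : CovTensor I M) (hg : IsPseudoRiemannianMetric I g)
    (K : ContraTensor I M) (hK : IsSymmetricTensorField I K)
    (D : Distribution I M) (hD : IsKillingDistribution I g D) (hKD : IsInvariant I g K D)
    (gB : CovTensor IB B) (gF : CovTensor IF F) (ρ : B → ℝ) (φ : B × F → M)
    (hφ : IsAdaptedWarpedProduct IB IF I g D gB gF ρ φ) :
    (KillingEquationOn I g K (Set.range φ) ↔
      ∃ (K' : ContraTensor IB B) (Kt : ContraTensor IF F) (t : B → ℝ),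
        IsKillingTensor IB gB K' ∧ IsKillingTensor IF gF Kt ∧ ContMDiff IB 𝓘(ℝ, ℝ) ∞ t ∧
        (∀ z : B × F, K (φ z) = pushforward (IB.prod IF) I φ z
          (liftBase IB IF K' z + t z.1 • liftFiber IB IF (cometric IF gF) z
            + liftFiber IB IF Kt z)) ∧
        (∀ b : B, mvfderiv IB t b = gB b (K' b (mvfderiv IB (fun b' ↦ (ρ b' ^ 2)⁻¹) b)))) ∧
    (∀ Kt : ContraTensor IF F, IsKillingTensor IF gF Kt →
      IsKillingTensor (IB.prod IF) (warpedMetric IB IF gB gF ρ) (liftFiber IB IF Kt)) := by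
  have : Nontrivial EF := Module.nontrivial_of_finrank_pos hφ.fiber_dim_pos
  have hρ₀ (b : B) : ρ b ≠ 0 := (hφ.warp_pos b).ne'
  refine ⟨?_, fun Kt hKt ↦ hKt.liftFiber hφ.metric_base hφ.metric_fiber hφ.warp_smooth hρ₀⟩
  rw [killingEquationOn_range_iff hφ.localDiffeo hK hg.isSymmetricTensorField_cometric,
    funext hφ.isometry,
    killingEquationOn_warpedMetric_iff_exists hφ.metric_base hφ.metric_fiber hφ.warp_smooth hρ₀
      (hK.pullbackContra hφ.localDiffeo) (hφ.isBlockDiagonal_pullbackContra hK hKD)]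
  simp only [pullbackContra_eq_iff hφ.localDiffeo]
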